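/- Let $\mathfrak g$ be a finite-dimensional complex simple Lie algebra with Killing form $(\cdot,\cdot)$, let $\mathfrak t$ be a Cartan subalgebra, $\ell=\dim\mathfrak t$ the rank, $\Delta$ the set of roots, and identify $\mathfrak t$ with its dual through the Killing form, so that $\Delta\subset\mathfrak t$. Let $\mathfrak h$ be the real span of $\Delta$ in $\mathfrak t$. Fix simple roots $\{\alpha_1,\dots,\alpha_\ell\}$, with positive roots $\Delta_+$ and highest root $\psi$ (the root of largest height), and put $\rho=\tfrac12\sum_{\varphi\in\Delta_+}\varphi$. The affine Weyl group $W_f=\Gamma\rtimes W$ is the group of all affine transformations $x\mapsto\gamma+w(x)$ of $\mathfrak h$ with $w$ in the Weyl group $W$ (generated by the reflections in the roots) and $\gamma$ in the lattice $\Gamma$ generated by the coroots $\varphi^\vee=2\varphi/(\varphi,\varphi)$, $\varphi\in\Delta$. Let $$\mathfrak h^+=\{x\in\mathfrak h : (\varphi,x)\ge 0\ \ \forall \varphi\in\Delta_+\},\qquad A_1=\{x\in\mathfrak h : (\alpha_i,x)\ge 0\ \ \forall i,\ (\psi,x)\le 1\},\qquad A_\sigma=\sigma(A_1)\quad(\sigma\in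 W_f),$$ $$W_f^+=\{\sigma\in W_f : A_\sigma\subset\mathfrak h^+\},\qquad W_f^{(2)}=\{\sigma\in W_f^+ : A_\sigma\subset 2A_1\},\qquad 2A_1=\{x\in\mathfrak h^+ : (\psi,x)\le 2\}.$$ For $\sigma\in W_f$ put $\lambda^\sigma=\tfrac12\sigma(2\rho)-\rho$, and let $D_{alcove}=\{\lambda^\sigma : \sigma\in W_f^+\}$. Let $\mathfrak b=\mathfrak t\oplus\bigoplus_{\varphi\in\Delta_+}\mathfrak g_\varphi$ be the Borel subalgebra, let $\Xi$ index the set of all abelian ideals $\mathfrak a_\xi$ of $\mathfrak b$, and for $\xi\in\Xi$ let $\lambda_\xi$ be the sum of all roots $\varphi$ whose root space $\mathfrak g_\varphi$ is contained in $\mathfrak a_\xi$. **Theorem.** For every $\xi\in\Xi$ there exists a unique element $\sigma_\xi\in W_f^+$ such that $\lambda_\xi=\lambda^{\sigma_\xi}$. Moreover $\sigma_\xi\in W_f^{(2)}$, and the map $\Xi\to W_f^{(2)}$, $\xi\mapsto\sigma_\xi$, is a bijection. In particular $\{\lambda_\xi : \xi\in\Xi\}\subset D_{alcove}$, and $\operatorname{card}\Xi=2^\ell$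 (Peterson's theorem). -/

import Mathlib

noncomputable section

open Module LieAlgebra LieAlgebra.IsKilling

namespace LieAlcove

variable {𝔤 : Type*} [LieRing 𝔤] [LieAlgebra ℂ 𝔤] [FiniteDimensional ℂ 𝔤] [LieAlgebra.IsSimple ℂ 𝔤]

/-! ### The real form of the Cartan subalgebra -/

section RealForm

variable (H : LieSubalgebra ℂ 𝔤) [H.IsCartanSubalgebra]

/-- A root regarded as an element of the Cartan subalgebra, by identifying the Cartan subalgebra
with its dual through the Killing form of `𝔤`. -/
def rootVec (φ : H.root) : H := (cartanEquivDual H).symm (φ.1 : H →ₗ[ℂ] ℂ)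

/-- The real form `𝔥` of the Cartan subalgebra: the real span of the roots (regarded as elements
of the Cartan subalgebra through the Killing form). -/
def realCartan : Submodule ℝ H := Submodule.span ℝ (Set.range (rootVec H))

variable {H}

theorem exists_real_norm (φ : H.root) :
    ∃ c : ℝ, c ≠ 0 ∧ φ.1 (rootVec H φ) = (c : ℂ) := by
  have hne : φ.1 (rootVec H φ) ≠ 0 :=
    root_apply_cartanEquivDual_symm_ne_zero (H.isNonZero_coe_root φ)
  have h1 : LieModule.traceForm ℂ H 𝔤 (coroot φ.1) (coroot φ.1)
      = 4 * (φ.1 (rootVec H φ))⁻¹ := by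
    rw [traceForm_coroot, root_apply_coroot (H.isNonZero_coe_root φ)]
    simp only [nsmul_eq_mul, smul_eq_mul, rootVec]
    push_cast
    ring
  have h2 : ∃ n : ℤ, LieModule.traceForm ℂ H 𝔤 (coroot φ.1) (coroot φ.1) = (n : ℂ) := by
    rw [← LieAlgebra.restrict_killingForm, restrict_killingForm_eq_sum]
    refine ⟨∑ α ∈ H.root, (((LieModule.chainBotCoeff φ.1 α : ℤ)
      - (LieModule.chainTopCoeff φ.1 α : ℤ)) ^ 2), ?_⟩
    rw [LinearMap.sum_apply, LinearMap.sum_apply]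
    push_cast
    refine Finset.sum_congr rfl fun α _ ↦ ?_
    simp only [LinearMap.smulRight_apply, LinearMap.smul_apply, smul_eq_mul,
      LieModule.Weight.toLinear_apply]
    rw [apply_coroot_eq_cast φ.1 α]
    push_cast
    ring
  obtain ⟨n, hn⟩ := h2
  rw [h1] at hn
  have hn0 : (n : ℂ) ≠ 0 := by
    rw [← hn]
    exact mul_ne_zero (by norm_num) (inv_ne_zero hne)
  refine ⟨4 / (n : ℝ), ?_, ?_⟩
  · have : (n : ℝ) ≠ 0 := by exact_mod_cast hn0
    positivity
  · push_cast
    rw [← hn]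
    field_simp

theorem rootVec_mem (φ : H.root) : rootVec H φ ∈ realCartan H :=
  Submodule.subset_span ⟨φ, rfl⟩

theorem coroot_eq_real_smul (φ : H.root) :
    ∃ c : ℝ, c ≠ 0 ∧ coroot φ.1 = c • rootVec H φ := by
  obtain ⟨c, hc, h⟩ := exists_real_norm φ
  refine ⟨2 * c⁻¹, mul_ne_zero two_ne_zero (inv_ne_zero hc), ?_⟩
  have : coroot φ.1 = 2 • (φ.1 (rootVec H φ))⁻¹ • rootVec H φ := rfl
  rw [this, h, ← Complex.coe_smul]
  push_cast
  rw [two_nsmul, two_mul, add_smul]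

theorem coroot_mem (φ : H.root) : coroot φ.1 ∈ realCartan H := by
  obtain ⟨c, -, h⟩ := coroot_eq_real_smul φ
  rw [h]
  exact Submodule.smul_mem _ _ (rootVec_mem φ)

variable (H)

/-- A root as an element of `𝔥`. -/
def rootElt (φ : H.root) : realCartan H := ⟨rootVec H φ, rootVec_mem φ⟩

/-- The coroot `φ^∨ = 2 φ / (φ, φ)` as an element of `𝔥`. -/
def corootElt (φ : H.root) : realCartan H := ⟨coroot φ.1, coroot_mem φ⟩

/-- The linear form `x ↦ (φ, x) = φ(x)` on `𝔥`; it is real valued by `rootForm_coe` below. -/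
def rootForm (φ : H.root) : realCartan H →ₗ[ℝ] ℝ where
  toFun x := (φ.1 (x : H)).re
  map_add' x y := by simp
  map_smul' c x := by
    have : φ.1 ((c • x : realCartan H) : H) = (c : ℂ) * φ.1 (x : H) := by
      rw [Submodule.coe_smul, ← Complex.coe_smul, map_smul, smul_eq_mul]
    rw [this]
    simp

variable {H}

theorem rootForm_coe (φ : H.root) (x : realCartan H) :
    ((rootForm H φ x : ℝ) : ℂ) = φ.1 (x : H) := by
  suffices h : ∀ y ∈ realCartan H, ∃ r : ℝ, φ.1 y = (r : ℂ) by
    obtain ⟨r, hr⟩ := h x x.2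
    simp [rootForm, hr]
  intro y hy
  induction hy using Submodule.span_induction with
  | mem y hy =>
    obtain ⟨α, rfl⟩ := hy
    obtain ⟨c, hc, h⟩ := coroot_eq_real_smul α
    have hv : rootVec H α = ((c⁻¹ : ℝ) : ℂ) • coroot α.1 := by
      rw [h, Complex.coe_smul, smul_smul, inv_mul_cancel₀ hc, one_smul]
    refine ⟨c⁻¹ * ((LieModule.chainBotCoeff α.1 φ.1 : ℝ)
      - (LieModule.chainTopCoeff α.1 φ.1 : ℝ)), ?_⟩
    rw [hv, map_smul, apply_coroot_eq_cast α.1 φ.1]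
    push_cast
    rfl
  | zero => exact ⟨0, by simp⟩
  | add y z _ _ hy hz =>
    obtain ⟨r, hr⟩ := hy
    obtain ⟨s, hs⟩ := hz
    exact ⟨r + s, by rw [map_add, hr, hs]; push_cast; rfl⟩
  | smul a y _ hy =>
    obtain ⟨r, hr⟩ := hy
    exact ⟨a * r, by rw [← Complex.coe_smul, map_smul, hr]; push_cast; rfl⟩

theorem rootForm_corootElt (φ : H.root) : rootForm H φ (corootElt H φ) = 2 := by
  have h := rootForm_coe φ (corootElt H φ)
  have h2 : φ.1 ((corootElt H φ : realCartan H) : H) = 2 :=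
    root_apply_coroot (H.isNonZero_coe_root φ)
  rw [h2] at h
  exact_mod_cast h

/-! ### The Weyl group and the affine Weyl group -/

variable (H)

/-- The reflection `s_φ(x) = x - (φ, x) φ^∨` of `𝔥`. -/
def rootReflection (φ : H.root) : realCartan H ≃ₗ[ℝ] realCartan H :=
  Module.reflection (rootForm_corootElt φ)

/-- The Weyl group, acting on `𝔥`. -/
def weylGroup : Subgroup (realCartan H ≃ₗ[ℝ] realCartan H) :=
  Subgroup.closure (Set.range (rootReflection H))

/-- The lattice `Γ` in `𝔥` generated by the coroots. -/
def corootLattice : AddSubgroup (realCartan H) :=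
  AddSubgroup.closure (Set.range (corootElt H))

variable {H}

theorem corootElt_mem (φ : H.root) : corootElt H φ ∈ corootLattice H :=
  AddSubgroup.subset_closure ⟨φ, rfl⟩

theorem rootReflection_mem_corootLattice (φ : H.root) {γ : realCartan H}
    (hγ : γ ∈ corootLattice H) : rootReflection H φ γ ∈ corootLattice H := by
  induction hγ using AddSubgroup.closure_induction with
  | mem x hx =>
    obtain ⟨α, rfl⟩ := hx
    have h : rootForm H φ (corootElt H α) = (((LieModule.chainBotCoeff α.1 φ.1 : ℤ)
        - (LieModule.chainTopCoeff α.1 φ.1 : ℤ) : ℤ) : ℝ) := by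
      have h := rootForm_coe φ (corootElt H α)
      have h2 : φ.1 ((corootElt H α : realCartan H) : H) = _ := apply_coroot_eq_cast α.1 φ.1
      rw [h2] at h
      exact_mod_cast h
    rw [rootReflection, Module.reflection_apply, h, Int.cast_smul_eq_zsmul]
    exact sub_mem (corootElt_mem α) (zsmul_mem (corootElt_mem φ) _)
  | zero => simp
  | add x y _ _ hx hy => rw [map_add]; exact add_mem hx hy
  | neg x _ hx => rw [map_neg]; exact neg_mem hx

theorem weylGroup_mem_corootLattice {w : realCartan H ≃ₗ[ℝ] realCartan H}
    (hw : w ∈ weylGroup H) :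
    ∀ γ ∈ corootLattice H, w γ ∈ corootLattice H := by
  induction hw using Subgroup.closure_induction'' with
  | mem w hw =>
    obtain ⟨φ, rfl⟩ := hw
    exact fun γ hγ ↦ rootReflection_mem_corootLattice φ hγ
  | inv_mem w hw =>
    obtain ⟨φ, rfl⟩ := hw
    exact fun γ hγ ↦ rootReflection_mem_corootLattice φ hγ
  | one => exact fun γ hγ ↦ hγ
  | mul w v _ _ hw hv => exact fun γ hγ ↦ hw _ (hv _ hγ)

variable (H)

/-- The affine Weyl group `W_f = Γ ⋊ W`, as the group of all affine transformations
`x ↦ γ + w(x)` of `𝔥`, with `γ` in the coroot lattice and `w` in the Weyl group. -/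
def affineWeylGroup : Subgroup (realCartan H ≃ᵃ[ℝ] realCartan H) where
  carrier := {σ | ∃ γ ∈ corootLattice H, ∃ w ∈ weylGroup H, ∀ x, σ x = γ + w x}
  one_mem' := ⟨0, zero_mem _, 1, one_mem _, fun x ↦ by simp⟩
  mul_mem' := by
    rintro σ τ ⟨γ, hγ, w, hw, h⟩ ⟨δ, hδ, v, hv, h'⟩
    refine ⟨γ + w δ, add_mem hγ (weylGroup_mem_corootLattice hw δ hδ), w * v, mul_mem hw hv,
      fun x ↦ ?_⟩
    simp [h, h', add_assoc]
  inv_mem' := by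
    rintro σ ⟨γ, hγ, w, hw, h⟩
    refine ⟨-(w⁻¹ γ), neg_mem (weylGroup_mem_corootLattice (inv_mem hw) γ hγ), w⁻¹, inv_mem hw,
      fun x ↦ ?_⟩
    have hww : ∀ y, w (w⁻¹ y) = y := fun y ↦ w.apply_symm_apply y
    apply σ.injective
    have : σ (σ⁻¹ x) = x := σ.apply_symm_apply x
    rw [this, h, map_add, map_neg, hww, hww]
    abel

end RealForm

/-! ### Alcoves and the weights attached to them -/

section Alcoves

variable {H : LieSubalgebra ℂ 𝔤} [H.IsCartanSubalgebra] (b : (rootSystem H).Base)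

theorem exists_highest : ∃ ψ : H.root, ∀ φ : H.root, b.height φ ≤ b.height ψ := by
  have : Nontrivial (Dual ℂ H) := RootPairing.IsIrreducible.nontrivial (rootSystem H)
  have : Nonempty H.root := by
    by_contra h
    rw [not_nonempty_iff] at h
    have h1 := RootPairing.IsRootSystem.span_root_eq_top (P := rootSystem H)
    rw [Set.range_eq_empty, Submodule.span_empty] at h1
    exact bot_ne_top h1
  exact Finite.exists_max b.height

/-- The highest root `ψ`: the root of largest height with respect to the simple roots. -/
def highestRoot : H.root := (exists_highest b).choose

/-- The closed Weyl chamber `𝔥⁺`. -/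
def chamber : Set (realCartan H) := {x | ∀ φ : H.root, b.IsPos φ → 0 ≤ rootForm H φ x}

/-- The fundamental alcove `A₁`. -/
def fundamentalAlcove : Set (realCartan H) :=
  {x | (∀ α ∈ b.support, 0 ≤ rootForm H α x) ∧ rootForm H (highestRoot b) x ≤ 1}

/-- The alcove `A_σ = σ(A₁)`. -/
def alcove (σ : affineWeylGroup H) : Set (realCartan H) := σ.1 '' fundamentalAlcove b

/-- The set `W_f⁺` of the elements of the affine Weyl group whose alcove is dominant. -/
def dominantElements : Set (affineWeylGroup H) := {σ | alcove b σ ⊆ chamber b}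

/-- The region `𝔥^(k)` of the Weyl chamber cut out by `(ψ, x) ≤ k`. -/
def truncatedChamber (k : ℕ) : Set (realCartan H) :=
  {x | x ∈ chamber b ∧ rootForm H (highestRoot b) x ≤ k}

/-- The set `W_f^(k)` of those `σ` in `W_f⁺` whose alcove lies in `𝔥^(k)`. -/
def truncatedElements (k : ℕ) : Set (affineWeylGroup H) :=
  {σ | σ ∈ dominantElements b ∧ alcove b σ ⊆ truncatedChamber b k}

open Classical in
/-- The sum of a set of roots, in `𝔥`. -/
def rootSum (Φ : Set H.root) : realCartan H := ∑ φ ∈ Finset.univ.filter (· ∈ Φ), rootElt H φ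

/-- Half the sum of the positive roots. -/
def rho : realCartan H := (1 / 2 : ℝ) • rootSum {φ | b.IsPos φ}

/-- The weight `λ^σ = σ(2ρ)/2 - ρ`. -/
def alcoveWeight (σ : affineWeylGroup H) : realCartan H :=
  (1 / 2 : ℝ) • σ.1 ((2 : ℝ) • rho b) - rho b

/-- The set `D_alcove = {λ^σ | σ ∈ W_f⁺}`. -/
def alcoveWeights : Set (realCartan H) := alcoveWeight b '' dominantElements b

end Alcoves

/-! ### The Borel subalgebra and its abelian ideals -/

section Borel

variable {H : LieSubalgebra ℂ 𝔤} [H.IsCartanSubalgebra] (b : (rootSystem H).Base)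

theorem lie_mem_of_isPos {α β : H.root} (hα : b.IsPos α) (hβ : b.IsPos β) {x y : 𝔤}
    (hx : x ∈ rootSpace H α.1) (hy : y ∈ rootSpace H β.1) :
    ⁅x, y⁆ = 0 ∨ ∃ γ : H.root, b.IsPos γ ∧ ⁅x, y⁆ ∈ rootSpace H γ.1 := by
  have h := LieAlgebra.lie_mem_genWeightSpace_of_mem_genWeightSpace hx hy
  by_cases hbot : rootSpace H ((α.1 : H → ℂ) + β.1) = ⊥
  · left
    change _ ∈ rootSpace H _ at h
    rw [hbot] at h
    simpa using h
  right
  let γ : LieModule.Weight ℂ H 𝔤 := ⟨(α.1 : H → ℂ) + β.1, hbot⟩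
  have hγ : γ.IsNonZero := by
    intro h0
    have h1 : (α.1 : H → ℂ) + β.1 = 0 := h0
    have h2 : α = (rootSystem H).reflectionPerm β β := by
      apply (rootSystem H).root.injective
      rw [RootPairing.root_reflectionPerm, RootPairing.reflection_apply_self]
      ext z
      have := congrFun h1 z
      simp only [Pi.add_apply, Pi.zero_apply] at this
      simpa using eq_neg_of_add_eq_zero_left this
    have h3 : b.height ((rootSystem H).reflectionPerm β β) = -b.height β :=
      b.height_reflectionPerm_self β
    rw [RootPairing.Base.isPos_iff] at hα hβ
    rw [h2] at hα
    omega
  have hmem : γ ∈ H.root := by simpa [LieSubalgebra.root] using hγ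
  refine ⟨⟨γ, hmem⟩, hα.add hβ ?_, h⟩
  ext z
  rfl

/-- The Borel subalgebra `𝔟`: the sum of the Cartan subalgebra and of the root spaces of the
positive roots. -/
def borel : LieSubalgebra ℂ 𝔤 where
  toSubmodule := H.toSubmodule ⊔
    ⨆ (φ : H.root) (_ : b.IsPos φ), (rootSpace H φ.1).toSubmodule
  lie_mem' := by
    set S : Submodule ℂ 𝔤 := H.toSubmodule ⊔
      ⨆ (φ : H.root) (_ : b.IsPos φ), (rootSpace H φ.1).toSubmodule with hS
    have hr : ∀ {φ : H.root}, b.IsPos φ → ∀ {x}, x ∈ rootSpace H φ.1 → x ∈ S := by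
      intro φ hφ x hx
      exact Submodule.mem_sup_right (Submodule.mem_iSup_of_mem φ
        (Submodule.mem_iSup_of_mem hφ hx))
    have hh : ∀ {x}, x ∈ H → x ∈ S := fun hx ↦ Submodule.mem_sup_left hx
    have hl : ∀ {x y : 𝔤} {φ : H.root}, x ∈ H → y ∈ rootSpace H φ.1 →
        ⁅x, y⁆ ∈ rootSpace H φ.1 := fun {x y φ} hx hy ↦
      (rootSpace H φ.1).lie_mem (x := ⟨x, hx⟩) hy
    let U : Set 𝔤 := {x | x ∈ H ∨ ∃ φ : H.root, b.IsPos φ ∧ x ∈ rootSpace H φ.1}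
    have hSU : S = Submodule.span ℂ U := by
      apply le_antisymm
      · refine sup_le (fun x hx ↦ Submodule.subset_span (Or.inl hx))
          (iSup₂_le fun φ hφ x hx ↦ Submodule.subset_span (Or.inr ⟨φ, hφ, hx⟩))
      · rw [Submodule.span_le]
        rintro x (hx | ⟨φ, hφ, hx⟩)
        · exact hh hx
        · exact hr hφ hx
    have key : ∀ x ∈ U, ∀ y ∈ U, ⁅x, y⁆ ∈ S := by
      rintro x (hx | ⟨φ, hφ, hx⟩) y (hy | ⟨θ, hθ, hy⟩)
      · exact hh (H.lie_mem hx hy)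
      · exact hr hθ (hl hx hy)
      · rw [← lie_skew]
        exact neg_mem (hr hφ (hl hy hx))
      · rcases lie_mem_of_isPos b hφ hθ hx hy with h | ⟨γ, hγ, h⟩
        · rw [h]
          exact zero_mem _
        · exact hr hγ h
    intro x y hx hy
    change x ∈ S at hx
    change y ∈ S at hy
    change ⁅x, y⁆ ∈ S
    rw [hSU] at hx hy
    induction hx using Submodule.span_induction with
    | mem x hx =>
      induction hy using Submodule.span_induction with
      | mem y hy => exact key x hx y hy
      | zero => simp
      | add y z _ _ hy hz => rw [lie_add]; exact add_mem hy hz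
      | smul a y _ hy => rw [lie_smul]; exact Submodule.smul_mem _ _ hy
    | zero => simp
    | add x z _ _ hx hz => rw [add_lie]; exact add_mem hx hz
    | smul a x _ hx => rw [smul_lie]; exact Submodule.smul_mem _ _ hx

/-- The set `Ξ` of all abelian ideals of the Borel subalgebra. -/
abbrev AbelianIdeal : Type _ := {I : LieIdeal ℂ (borel b) // IsLieAbelian I}

/-- An abelian ideal of the Borel subalgebra as a subspace of `𝔤`. -/
def AbelianIdeal.toSubspace (ξ : AbelianIdeal b) : Submodule ℂ 𝔤 :=
  ξ.1.toSubmodule.map (borel b).toSubmodule.subtype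

variable (H) in
/-- The set `Δ(𝔳)` of the roots whose (one-dimensional) root space lies in a subspace `𝔳`. -/
def rootsOf (V : Submodule ℂ 𝔤) : Set H.root := {φ | (rootSpace H φ.1).toSubmodule ≤ V}

/-- The weight `λ_ξ`, the sum of the roots of the abelian ideal `𝔞_ξ`. -/
def idealWeight (ξ : AbelianIdeal b) : realCartan H := rootSum (rootsOf H (ξ.toSubspace b))

end Borel

end LieAlcove

end

noncomputable section

open Module LieAlgebra LieAlgebra.IsKilling

namespace LieAlcove

variable {𝔤 : Type*} [LieRing 𝔤] [LieAlgebra ℂ 𝔤] [FiniteDimensional ℂ 𝔤] [LieAlgebra.IsSimple ℂ 𝔤]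
variable {H : LieSubalgebra ℂ 𝔤} [H.IsCartanSubalgebra]

section

/-! ### Roots as linear forms on the real form -/

/-! The mechanism is the formula `λ^σ = ∑_{φ>0} ⌊φ(σ(2ρ))⌋ φ` (`alcoveWeight_eq`). It comes from the
sum `∑ ⌊α(y)⌋ α` over all roots, which is equivariant under the affine Weyl group: the linear part
permutes the roots, and a translation by `γ` contributes `∑ α(γ) α = γ`, because the Killing form is
`∑ α ⊗ α`. This sum is constantly `2ρ` on the open fundamental alcove, and `2ρ` itself lies there,
since `(α_i, 2ρ) = (α_i, α_i) > 0` and `(ψ, 2ρ) = 1 - (ψ, ψ) < 1`. As the group acts freely on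
interior points (`affineWeyl_eq_one`), `λ^σ` determines `σ`.

When `A_σ ⊂ 2A₁`, the integers `⌊φ(σ(2ρ))⌋` are `0` or `1` on positive roots, so `λ^σ` is the sum of
the roots with value `1`; superadditivity of the floor makes these the roots of an abelian ideal. An
abelian ideal is determined by its roots, because it is stable under the Cartan subalgebra and meets
it in zero. Conversely, the indicator function of an abelian set of roots, extended by `k(-α) =
-k(α) - 1`, is superadditive, and a theorem of the alternative yields a point having it as integral
parts (`exists_floor_eq`). Moving that point into the open fundamental alcove produces `σ`.

For the count, `σ` lies in `W_f^(2)` exactly when `½σ(2ρ)` is interior to `A₁`. Conjugation by the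
dilation by `2` carries affine Weyl elements with translation part in `2Γ` back into the group, so
freeness and transitivity on alcoves make `σ ↦ σ⁻¹(0)` a bijection from `W_f^(2)` onto `Γ/2Γ`, which
has `2^ℓ` elements. -/

theorem rootForm_complex (φ : H.root) (x : realCartan H) :
    ((rootForm H φ x : ℝ) : ℂ) = (rootSystem H).root φ (x : H) :=
  rootForm_coe φ x

theorem rootForm_eq_sum {ι : Type*} (s : Finset ι) (f : ι → ℤ) (r : ι → H.root) {φ : H.root}
    (h : (rootSystem H).root φ = ∑ i ∈ s, f i • (rootSystem H).root (r i)) (x : realCartan H) :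
    rootForm H φ x = ∑ i ∈ s, (f i : ℝ) * rootForm H (r i) x := by
  have : ((rootForm H φ x : ℝ) : ℂ) = ((∑ i ∈ s, (f i : ℝ) * rootForm H (r i) x : ℝ) : ℂ) := by
    rw [rootForm_complex, h]
    rw [LinearMap.sum_apply]
    push_cast
    refine Finset.sum_congr rfl fun i _ ↦ ?_
    rw [LinearMap.smul_apply, rootForm_complex, zsmul_eq_mul]
  exact_mod_cast this

theorem rootForm_add {φ α β : H.root}
    (h : (rootSystem H).root φ = (rootSystem H).root α + (rootSystem H).root β)
    (x : realCartan H) : rootForm H φ x = rootForm H α x + rootForm H β x := by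
  have : ((rootForm H φ x : ℝ) : ℂ) = ((rootForm H α x + rootForm H β x : ℝ) : ℂ) := by
    push_cast
    simp only [rootForm_complex, h, LinearMap.add_apply]
  exact_mod_cast this

/-- The negative of a root. -/
def negRoot (φ : H.root) : H.root := (rootSystem H).reflectionPerm φ φ

theorem root_negRoot (φ : H.root) :
    (rootSystem H).root (negRoot φ) = -(rootSystem H).root φ := by
  rw [negRoot, RootPairing.root_reflectionPerm, RootPairing.reflection_apply_self]

theorem coroot_negRoot (φ : H.root) :
    (rootSystem H).coroot (negRoot φ) = -(rootSystem H).coroot φ := by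
  rw [negRoot, RootPairing.coroot_reflectionPerm, RootPairing.coreflection_apply_self]

theorem negRoot_negRoot (φ : H.root) : negRoot (negRoot φ) = φ := by
  apply (rootSystem H).root.injective
  rw [root_negRoot, root_negRoot, neg_neg]

theorem rootForm_negRoot (φ : H.root) (x : realCartan H) :
    rootForm H (negRoot φ) x = -rootForm H φ x := by
  have : ((rootForm H (negRoot φ) x : ℝ) : ℂ) = ((-rootForm H φ x : ℝ) : ℂ) := by
    push_cast
    simp only [rootForm_complex, root_negRoot, LinearMap.neg_apply]
  exact_mod_cast this

theorem corootElt_negRoot (φ : H.root) : corootElt H (negRoot φ) = -corootElt H φ :=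
  Subtype.ext (coroot_negRoot φ)

theorem height_negRoot (b : (rootSystem H).Base) (φ : H.root) :
    b.height (negRoot φ) = -b.height φ :=
  b.height_reflectionPerm_self φ

theorem isPos_negRoot (b : (rootSystem H).Base) (φ : H.root) :
    b.IsPos (negRoot φ) ↔ ¬ b.IsPos φ :=
  RootPairing.Base.IsPos.neg_iff_not b φ

theorem isPos_or_isPos_negRoot (b : (rootSystem H).Base) (φ : H.root) :
    b.IsPos φ ∨ b.IsPos (negRoot φ) :=
  RootPairing.Base.IsPos.or_neg b φ

theorem rootForm_corootElt_eq (φ α : H.root) :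
    rootForm H φ (corootElt H α) = ((rootSystem H).pairingIn ℤ φ α : ℝ) := by
  have : ((rootForm H φ (corootElt H α) : ℝ) : ℂ)
      = (((rootSystem H).pairingIn ℤ φ α : ℝ) : ℂ) := by
    rw [rootForm_complex]
    have h := (rootSystem H).algebraMap_pairingIn ℤ φ α
    simp only [algebraMap_int_eq, eq_intCast] at h
    rw [Complex.ofReal_intCast, h]
    rfl
  exact_mod_cast this

theorem rootReflection_apply (α : H.root) (x : realCartan H) :
    rootReflection H α x = x - rootForm H α x • corootElt H α :=
  Module.reflection_apply _ _

theorem rootForm_rootReflection (φ α : H.root) (x : realCartan H) :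
    rootForm H φ (rootReflection H α x)
      = rootForm H φ x - rootForm H α x * (rootSystem H).pairingIn ℤ φ α := by
  rw [rootReflection_apply, map_sub, map_smul, smul_eq_mul, rootForm_corootElt_eq]

theorem root_reflectionPerm_eq (φ α : H.root) :
    (rootSystem H).root ((rootSystem H).reflectionPerm α φ)
      = (rootSystem H).root φ - (rootSystem H).pairingIn ℤ φ α • (rootSystem H).root α := by
  rw [RootPairing.root_reflectionPerm, RootPairing.reflection_apply_root' ℤ]

theorem rootForm_reflectionPerm (φ α : H.root) (x : realCartan H) :
    rootForm H ((rootSystem H).reflectionPerm α φ) x = rootForm H φ (rootReflection H α x) := by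
  have h : ((rootForm H ((rootSystem H).reflectionPerm α φ) x : ℝ) : ℂ)
      = ((rootForm H φ x - rootForm H α x * (rootSystem H).pairingIn ℤ φ α : ℝ) : ℂ) := by
    push_cast
    simp only [rootForm_complex, root_reflectionPerm_eq, LinearMap.sub_apply,
      LinearMap.smul_apply, zsmul_eq_mul]
    ring
  rw [rootForm_rootReflection]
  exact_mod_cast h

theorem rootReflection_corootElt (α β : H.root) :
    rootReflection H α (corootElt H β)
      = corootElt H ((rootSystem H).reflectionPerm α β) := by
  apply Subtype.ext
  have h : ((corootElt H ((rootSystem H).reflectionPerm α β) : realCartan H) : H)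
      = (rootSystem H).coroot ((rootSystem H).reflectionPerm α β) := rfl
  rw [h, RootPairing.coroot_reflectionPerm, RootPairing.coreflection_apply, rootReflection_apply,
    rootForm_corootElt_eq]
  have h2 := (rootSystem H).algebraMap_pairingIn ℤ α β
  simp only [algebraMap_int_eq, eq_intCast] at h2
  rw [Submodule.coe_sub, Submodule.coe_smul, ← Complex.coe_smul, Complex.ofReal_intCast, h2]
  rfl

/-- The weights have no common kernel on the Cartan subalgebra, and the zero weight imposes no
condition. Identities in `𝔥` are therefore tested against the roots. -/
theorem eq_zero_of_rootForm_eq_zero {x : realCartan H} (h : ∀ φ, rootForm H φ x = 0) : x = 0 := by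
  apply Subtype.ext
  have hx : (x : H) ∈ ⨅ α : LieModule.Weight ℂ H 𝔤, α.ker := by
    refine (Submodule.mem_iInf _).mpr fun μ ↦ ?_
    by_cases hμ : μ.IsNonZero
    · have hmem : μ ∈ H.root := by simpa [LieSubalgebra.root] using hμ
      have h1 := rootForm_coe ⟨μ, hmem⟩ x
      rw [h] at h1
      exact h1.symm
    · simp only [LieModule.Weight.IsNonZero, not_not] at hμ
      exact LinearMap.mem_ker.mpr (congr_fun hμ _)
  rw [iInf_ker_weight_eq_bot] at hx
  simpa using hx

theorem eq_of_rootForm_eq {x y : realCartan H} (h : ∀ φ, rootForm H φ x = rootForm H φ y) :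
    x = y := by
  rw [← sub_eq_zero]
  exact eq_zero_of_rootForm_eq_zero fun φ ↦ by rw [map_sub, h, sub_self]

/-! ### The Killing form on the real form -/

/-- The Killing form restricted to `𝔥`. -/
def killing (x y : realCartan H) : ℝ := ∑ α : H.root, rootForm H α x * rootForm H α y

theorem killing_comm (x y : realCartan H) : killing x y = killing y x :=
  Finset.sum_congr rfl fun _ _ ↦ mul_comm _ _

theorem killing_sub_left (x y z : realCartan H) : killing (x - y) z = killing x z - killing y z := by
  simp only [killing, map_sub, sub_mul, Finset.sum_sub_distrib]

theorem killing_smul_left (c : ℝ) (x y : realCartan H) : killing (c • x) y = c * killing x y := by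
  simp only [killing, map_smul, smul_eq_mul, Finset.mul_sum, mul_assoc]

theorem killing_sub_right (x y z : realCartan H) :
    killing x (y - z) = killing x y - killing x z := by
  rw [killing_comm, killing_sub_left, killing_comm y, killing_comm z]

theorem killing_smul_right (c : ℝ) (x y : realCartan H) : killing x (c • y) = c * killing x y := by
  rw [killing_comm, killing_smul_left, killing_comm]

theorem killing_self_nonneg (x : realCartan H) : 0 ≤ killing x x :=
  Finset.sum_nonneg fun _ _ ↦ mul_self_nonneg _

theorem sq_rootForm_le_killing (α : H.root) (x : realCartan H) :
    rootForm H α x * rootForm H α x ≤ killing x x :=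
  Finset.single_le_sum (f := fun α ↦ rootForm H α x * rootForm H α x)
    (fun _ _ ↦ mul_self_nonneg _) (Finset.mem_univ α)

theorem killing_self_pos {x : realCartan H} (hx : x ≠ 0) : 0 < killing x x := by
  refine lt_of_le_of_ne (killing_self_nonneg x) fun h ↦ hx ?_
  refine eq_zero_of_rootForm_eq_zero fun φ ↦ ?_
  have := sq_rootForm_le_killing φ x
  rw [← h] at this
  nlinarith [mul_self_nonneg (rootForm H φ x)]

/-- The adjoint action of the Cartan subalgebra is diagonal with the roots as eigenvalues, so the
trace is a sum over roots. -/
theorem killing_coe (x y : realCartan H) :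
    ((killing x y : ℝ) : ℂ) = LieModule.traceForm ℂ H 𝔤 (x : H) (y : H) := by
  rw [← LieAlgebra.restrict_killingForm, restrict_killingForm_eq_sum, killing,
    ← Finset.sum_coe_sort H.root, LinearMap.sum_apply, LinearMap.sum_apply]
  push_cast
  refine Finset.sum_congr rfl fun α _ ↦ ?_
  simp only [LinearMap.smulRight_apply, LinearMap.smul_apply, smul_eq_mul,
    LieModule.Weight.toLinear_apply, rootForm_coe]

theorem killing_rootElt (φ : H.root) (x : realCartan H) :
    killing (rootElt H φ) x = rootForm H φ x := by
  have h : ((killing (rootElt H φ) x : ℝ) : ℂ) = ((rootForm H φ x : ℝ) : ℂ) := by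
    rw [killing_coe, rootForm_coe]
    have : cartanEquivDual H ((cartanEquivDual H).symm (φ.1 : H →ₗ[ℂ] ℂ)) (x : H)
        = φ.1 (x : H) := by
      rw [LinearEquiv.apply_symm_apply]
      rfl
    exact this
  exact_mod_cast h

/-- The form `∑ α ⊗ α` is the very form used to identify roots with vectors, hence the constant `1`.
This normalization is what makes `floorSum` respect translations. -/
theorem sum_rootForm_smul_rootElt (x : realCartan H) :
    ∑ α : H.root, rootForm H α x • rootElt H α = x := by
  refine eq_of_rootForm_eq fun φ ↦ ?_
  rw [← killing_rootElt φ x, map_sum, killing]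
  refine Finset.sum_congr rfl fun α _ ↦ ?_
  rw [map_smul, smul_eq_mul, ← killing_rootElt φ, killing_comm, killing_rootElt, mul_comm]

theorem rootForm_rootElt_comm (φ α : H.root) :
    rootForm H φ (rootElt H α) = rootForm H α (rootElt H φ) := by
  rw [← killing_rootElt, killing_comm, killing_rootElt]

theorem rootElt_ne_zero (φ : H.root) : rootElt H φ ≠ 0 := by
  intro h
  have := killing_rootElt φ (corootElt H φ)
  rw [rootForm_corootElt, h] at this
  simp [killing] at this

theorem rootForm_rootElt_self_pos (φ : H.root) : 0 < rootForm H φ (rootElt H φ) := by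
  rw [← killing_rootElt]
  exact killing_self_pos (rootElt_ne_zero φ)

theorem smul_corootElt (φ : H.root) :
    rootForm H φ (rootElt H φ) • corootElt H φ = (2 : ℝ) • rootElt H φ := by
  obtain ⟨c, hc, h⟩ := coroot_eq_real_smul φ
  have h' : corootElt H φ = c • rootElt H φ := Subtype.ext h
  have h2 := rootForm_corootElt φ
  rw [h', map_smul, smul_eq_mul] at h2
  rw [h', smul_smul, mul_comm, h2]

theorem rootForm_rootElt (φ α : H.root) :
    2 * rootForm H φ (rootElt H α)
      = rootForm H α (rootElt H α) * (rootSystem H).pairingIn ℤ φ α := by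
  rw [← rootForm_corootElt_eq, ← smul_eq_mul (rootForm H α _), ← map_smul, smul_corootElt,
    map_smul, smul_eq_mul]

theorem rootElt_negRoot (φ : H.root) : rootElt H (negRoot φ) = -rootElt H φ := by
  refine eq_of_rootForm_eq fun θ ↦ ?_
  rw [map_neg, rootForm_rootElt_comm θ, rootForm_rootElt_comm θ, rootForm_negRoot]

theorem rootReflection_rootElt (α φ : H.root) :
    rootReflection H α (rootElt H φ) = rootElt H ((rootSystem H).reflectionPerm α φ) := by
  refine eq_of_rootForm_eq fun θ ↦ ?_
  rw [rootForm_rootElt_comm θ, rootForm_reflectionPerm, rootReflection_apply, rootReflection_apply]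
  simp only [map_sub, map_smul, smul_eq_mul]
  rw [rootForm_rootElt_comm θ φ]
  have h1 := smul_corootElt α
  have hpos := (rootForm_rootElt_self_pos α).ne'
  have h2 : ∀ θ : H.root, rootForm H α (rootElt H α) * rootForm H θ (corootElt H α)
      = 2 * rootForm H θ (rootElt H α) := fun θ ↦ by
    rw [← smul_eq_mul, ← map_smul, h1, map_smul, smul_eq_mul]
  congr 1
  apply mul_left_cancel₀ hpos
  rw [mul_left_comm, h2, mul_left_comm, rootForm_rootElt_comm α φ, rootForm_rootElt_comm θ α]
  linear_combination -(rootForm H α (rootElt H θ)) * h2 φ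

end

section

/-! ### Positive roots and the finite Weyl group -/

theorem exists_nat_coeff {b : (rootSystem H).Base} {φ : H.root} (hφ : b.IsPos φ) :
    ∃ f : H.root → ℕ, (∃ i ∈ b.support, f i ≠ 0) ∧ b.height φ = ∑ i ∈ b.support, (f i : ℤ) ∧
      (rootSystem H).root φ = ∑ i ∈ b.support, (f i : ℤ) • (rootSystem H).root i := by
  obtain ⟨f, -, hf, h⟩ := b.exists_root_eq_sum_int φ
  have hh := RootPairing.Base.height_eq_sum h
  have hpos : 0 < b.height φ := hφ
  have hf0 : 0 < f := by
    refine hf.resolve_right fun hneg ↦ ?_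
    rw [hh] at hpos
    exact absurd hpos (not_lt.mpr (Finset.sum_nonpos fun i _ ↦ hneg.le i))
  have hc : ∀ i, ((f i).toNat : ℤ) = f i := fun i ↦ Int.toNat_of_nonneg (hf0.le i)
  refine ⟨fun i ↦ (f i).toNat, ?_, ?_, ?_⟩
  · by_contra! hne
    rw [hh] at hpos
    refine hpos.ne' (Finset.sum_eq_zero fun i hi ↦ ?_)
    rw [← hc, hne i hi, Nat.cast_zero]
  · simp only [hc, hh]
  · simp only [hc, h]

theorem rootForm_pos_of_simple {b : (rootSystem H).Base} {x : realCartan H}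
    (hx : ∀ i ∈ b.support, 0 < rootForm H i x) {φ : H.root} (hφ : b.IsPos φ) :
    0 < rootForm H φ x := by
  obtain ⟨f, ⟨i, hi, hfi⟩, -, h⟩ := exists_nat_coeff hφ
  rw [rootForm_eq_sum _ _ (fun i ↦ i) h]
  refine Finset.sum_pos' (fun j hj ↦ mul_nonneg (by simp) (hx j hj).le)
    ⟨i, hi, mul_pos ?_ (hx i hi)⟩
  have : 0 < f i := Nat.pos_of_ne_zero hfi
  exact_mod_cast this

theorem rootForm_nonneg_of_simple {b : (rootSystem H).Base} {x : realCartan H}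
    (hx : ∀ i ∈ b.support, 0 ≤ rootForm H i x) {φ : H.root} (hφ : b.IsPos φ) :
    0 ≤ rootForm H φ x := by
  obtain ⟨f, -, -, h⟩ := exists_nat_coeff hφ
  rw [rootForm_eq_sum _ _ (fun i ↦ i) h]
  exact Finset.sum_nonneg fun j hj ↦ mul_nonneg (by simp) (hx j hj)

/-! ### Words in the simple reflections and freeness of the Weyl group -/

theorem reflectionPerm_reflectionPerm (α φ : H.root) :
    (rootSystem H).reflectionPerm α ((rootSystem H).reflectionPerm α φ) = φ :=
  (rootSystem H).reflectionPerm_involutive α φ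

theorem rootReflection_rootReflection (α : H.root) (x : realCartan H) :
    rootReflection H α (rootReflection H α x) = x :=
  Module.involutive_reflection _ x

theorem rootReflection_mul_self (α : H.root) : rootReflection H α * rootReflection H α = 1 :=
  LinearEquiv.ext fun x ↦ rootReflection_rootReflection α x

theorem rootReflection_inv (α : H.root) : (rootReflection H α)⁻¹ = rootReflection H α :=
  inv_eq_of_mul_eq_one_left (rootReflection_mul_self α)

theorem rootReflection_conj (α β : H.root) :
    rootReflection H α * rootReflection H ((rootSystem H).reflectionPerm α β)
      = rootReflection H β * rootReflection H α := by
  ext1 y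
  rw [LinearEquiv.mul_apply, LinearEquiv.mul_apply, rootReflection_apply (H := H) _ y, map_sub,
    map_smul, rootReflection_corootElt, reflectionPerm_reflectionPerm, rootForm_reflectionPerm,
    rootReflection_apply β]

theorem rootReflection_negRoot (α : H.root) :
    rootReflection H (negRoot α) = rootReflection H α := by
  ext1 y
  rw [rootReflection_apply, rootReflection_apply, rootForm_negRoot, corootElt_negRoot, smul_neg,
    neg_smul, neg_neg]

/-- The product of the simple reflections given by a list of simple roots. -/
def simpleProd (b : (rootSystem H).Base) (l : List b.support) :
    realCartan H ≃ₗ[ℝ] realCartan H :=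
  (l.map fun i : b.support ↦ rootReflection H i.1).prod

theorem simpleProd_nil (b : (rootSystem H).Base) : simpleProd b [] = 1 := rfl

theorem simpleProd_cons (b : (rootSystem H).Base) (i : b.support) (l : List b.support) :
    simpleProd b (i :: l) = rootReflection H i.1 * simpleProd b l := by
  simp [simpleProd]

theorem simpleProd_append (b : (rootSystem H).Base) (l m : List b.support) :
    simpleProd b (l ++ m) = simpleProd b l * simpleProd b m := by
  simp [simpleProd]

/-- Every root is reached from a simple one by negation and simple reflections; the first leaves the
reflection unchanged and the second conjugates it. -/
theorem exists_rootReflection_eq_simpleProd (b : (rootSystem H).Base) (φ : H.root) :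
    ∃ l, rootReflection H φ = simpleProd b l := by
  refine b.induction_reflect φ (p := fun φ ↦ ∃ l, rootReflection H φ = simpleProd b l) ?_ ?_ ?_
  · rintro i ⟨l, hl⟩
    exact ⟨l, (rootReflection_negRoot i).trans hl⟩
  · exact fun i hi ↦ ⟨[⟨i, hi⟩], by simp [simpleProd]⟩
  · rintro i j ⟨l, hl⟩ hj
    refine ⟨⟨j, hj⟩ :: (l ++ [⟨j, hj⟩]), ?_⟩
    rw [simpleProd_cons, simpleProd_append, ← hl, simpleProd_cons, simpleProd_nil, mul_one,
      ← rootReflection_conj, ← mul_assoc, rootReflection_mul_self, one_mul]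

theorem exists_eq_simpleProd (b : (rootSystem H).Base) {w : realCartan H ≃ₗ[ℝ] realCartan H}
    (hw : w ∈ weylGroup H) : ∃ l, w = simpleProd b l := by
  induction hw using Subgroup.closure_induction'' with
  | mem w hw =>
    obtain ⟨φ, rfl⟩ := hw
    exact exists_rootReflection_eq_simpleProd b φ
  | inv_mem w hw =>
    obtain ⟨φ, rfl⟩ := hw
    rw [rootReflection_inv]
    exact exists_rootReflection_eq_simpleProd b φ
  | one => exact ⟨[], rfl⟩
  | mul w v _ _ hw hv =>
    obtain ⟨l, rfl⟩ := hw
    obtain ⟨m, rfl⟩ := hv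
    exact ⟨l ++ m, (simpleProd_append b l m).symm⟩

/-- The exchange property. -/
theorem exists_shorter_of_rootForm_neg {b : (rootSystem H).Base} {z : realCartan H}
    (hz : ∀ φ, b.IsPos φ → 0 < rootForm H φ z) (l : List b.support) (β : H.root)
    (hβ : b.IsPos β) (h : rootForm H β (simpleProd b l z) < 0) :
    ∃ m : List b.support, m.length < l.length ∧
      rootReflection H β * simpleProd b l = simpleProd b m := by
  induction l generalizing β with
  | nil => exact absurd (hz β hβ) (not_lt.mpr h.le)
  | cons i l ih =>
    rw [simpleProd_cons]
    -- A simple reflection permutes the positive roots other than its own. So `β` stays positive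
    -- along the word until it equals the current letter, and that letter is the one deleted.
    by_cases hi : β = i.1
    · refine ⟨l, by simp, ?_⟩
      rw [hi, ← mul_assoc, rootReflection_mul_self, one_mul]
    · rw [simpleProd_cons, LinearEquiv.mul_apply, ← rootForm_reflectionPerm] at h
      obtain ⟨m, hm, hm'⟩ := ih _ (hβ.reflectionPerm i.2 hi) h
      refine ⟨i :: m, by simpa using hm, ?_⟩
      rw [← mul_assoc, ← rootReflection_conj, mul_assoc, hm', simpleProd_cons]

/-- The Weyl group acts freely on the interior of the Weyl chamber. -/
theorem weyl_eq_one_of_strictlyDominant {b : (rootSystem H).Base} {z : realCartan H}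
    (hz : ∀ φ, b.IsPos φ → 0 < rootForm H φ z) {w : realCartan H ≃ₗ[ℝ] realCartan H}
    (hw : w ∈ weylGroup H) (hwz : ∀ φ, b.IsPos φ → 0 < rootForm H φ (w z)) : w = 1 := by
  obtain ⟨l, rfl⟩ := exists_eq_simpleProd b hw
  clear hw
  induction hn : l.length using Nat.strong_induction_on generalizing l with
  | _ n ih =>
    cases l with
    | nil => rfl
    | cons i l =>
      have hi := b.isPos_of_mem_support i.2
      have h1 := hwz i.1 hi
      rw [simpleProd_cons, LinearEquiv.mul_apply, ← rootForm_reflectionPerm] at h1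
      -- The simple root `i` is positive on `w z`, hence negative on `s_i w z`; exchange rewrites
      -- the whole word as a shorter one.
      have h2 : rootForm H i.1 (simpleProd b l z) < 0 := by
        have := rootForm_negRoot i.1 (simpleProd b l z)
        rw [negRoot] at this
        linarith
      obtain ⟨m, hm, hm'⟩ := exists_shorter_of_rootForm_neg hz l i.1 hi h2
      rw [simpleProd_cons, hm'] at hwz ⊢
      refine ih m.length ?_ m hwz rfl
      rw [List.length_cons] at hn
      omega

/-- The permutation is `φ ↦ w⁻¹φ`; the same one serves for forms and for vectors because reflections
preserve the Killing form. -/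
theorem exists_perm_of_mem_weylGroup {w : realCartan H ≃ₗ[ℝ] realCartan H}
    (hw : w ∈ weylGroup H) : ∃ π : Equiv.Perm H.root,
      (∀ φ x, rootForm H φ (w x) = rootForm H (π φ) x) ∧
      ∀ φ, w (rootElt H (π φ)) = rootElt H φ := by
  have key : ∀ α : H.root, ∃ π : Equiv.Perm H.root,
      (∀ φ x, rootForm H φ (rootReflection H α x) = rootForm H (π φ) x) ∧
      ∀ φ, rootReflection H α (rootElt H (π φ)) = rootElt H φ := fun α ↦
    ⟨(rootSystem H).reflectionPerm α, fun φ x ↦ (rootForm_reflectionPerm φ α x).symm,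
      fun φ ↦ by rw [rootReflection_rootElt, reflectionPerm_reflectionPerm]⟩
  induction hw using Subgroup.closure_induction'' with
  | mem w hw =>
    obtain ⟨φ, rfl⟩ := hw
    exact key φ
  | inv_mem w hw =>
    obtain ⟨φ, rfl⟩ := hw
    rw [rootReflection_inv]
    exact key φ
  | one => exact ⟨1, fun _ _ ↦ rfl, fun _ ↦ rfl⟩
  | mul w v _ _ hw hv =>
    obtain ⟨π, h1, h2⟩ := hw
    obtain ⟨τ, h3, h4⟩ := hv
    refine ⟨τ * π, fun φ x ↦ ?_, fun φ ↦ ?_⟩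
    · rw [LinearEquiv.mul_apply, h1, h3, Equiv.Perm.mul_apply]
    · rw [LinearEquiv.mul_apply, Equiv.Perm.mul_apply, h4, h2]

/-! ### The coroot lattice -/

theorem exists_int_rootForm {γ : realCartan H} (hγ : γ ∈ corootLattice H) (φ : H.root) :
    ∃ n : ℤ, rootForm H φ γ = n := by
  induction hγ using AddSubgroup.closure_induction with
  | mem x hx =>
    obtain ⟨α, rfl⟩ := hx
    exact ⟨_, rootForm_corootElt_eq φ α⟩
  | zero => exact ⟨0, by simp⟩
  | add x y _ _ hx hy =>
    obtain ⟨m, hm⟩ := hx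
    obtain ⟨n, hn⟩ := hy
    exact ⟨m + n, by rw [map_add, hm, hn]; push_cast; rfl⟩
  | neg x _ hx =>
    obtain ⟨m, hm⟩ := hx
    exact ⟨-m, by rw [map_neg, hm]; push_cast; rfl⟩

/-- Signs are absorbed because the negative of a coroot is a coroot; the number of summands then
supports an induction. -/
theorem exists_multiset_of_mem_corootLattice {γ : realCartan H} (hγ : γ ∈ corootLattice H) :
    ∃ S : Multiset H.root, γ = (S.map (corootElt H)).sum := by
  induction hγ using AddSubgroup.closure_induction with
  | mem x hx =>
    obtain ⟨α, rfl⟩ := hx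
    exact ⟨{α}, by simp⟩
  | zero => exact ⟨0, by simp⟩
  | add x y _ _ hx hy =>
    obtain ⟨S, rfl⟩ := hx
    obtain ⟨T, rfl⟩ := hy
    exact ⟨S + T, by simp⟩
  | neg x _ hx =>
    obtain ⟨S, rfl⟩ := hx
    refine ⟨S.map negRoot, ?_⟩
    rw [Multiset.map_map, ← Multiset.sum_map_neg]
    simp only [Function.comp_apply, corootElt_negRoot]

/-- This is the usual fact on roots at an obtuse angle, applied to the dual root system. -/
theorem corootElt_add_of_pairingIn_neg {β δ : H.root}
    (h : (rootSystem H).pairingIn ℤ β δ < 0) :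
    corootElt H β + corootElt H δ = 0 ∨
      ∃ θ, corootElt H θ = corootElt H β + corootElt H δ := by
  by_cases h0 : (rootSystem H).coroot β = -(rootSystem H).coroot δ
  · left
    exact Subtype.ext (eq_neg_iff_add_eq_zero.mp h0)
  · right
    have h1 : (rootSystem H).flip.pairingIn ℤ δ β < 0 := by
      have : (rootSystem H).flip.pairingIn ℤ δ β = (rootSystem H).pairingIn ℤ β δ := by
        apply FaithfulSMul.algebraMap_injective ℤ ℂ
        rw [RootPairing.algebraMap_pairingIn, RootPairing.algebraMap_pairingIn]
        rfl
      rwa [this]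
    have h2 : (rootSystem H).flip.root δ ≠ -(rootSystem H).flip.root β := by
      intro h3
      apply h0
      change (rootSystem H).coroot δ = -(rootSystem H).coroot β at h3
      rw [h3, neg_neg]
    obtain ⟨θ, hθ⟩ := (rootSystem H).flip.root_add_root_mem_of_pairingIn_neg h1 h2
    refine ⟨θ, Subtype.ext ?_⟩
    rw [add_comm]
    exact hθ

/-- No nonzero element of the coroot lattice is minuscule. -/
theorem eq_zero_of_mem_corootLattice {γ : realCartan H} (hγ : γ ∈ corootLattice H)
    (h : ∀ φ, rootForm H φ γ ≤ 1) : γ = 0 := by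
  obtain ⟨S, rfl⟩ := exists_multiset_of_mem_corootLattice hγ
  clear hγ
  induction hn : S.card using Nat.strong_induction_on generalizing S with
  | _ n ih =>
    rcases S.empty_or_exists_mem with rfl | ⟨β, hβ⟩
    · simp
    · obtain ⟨T, rfl⟩ := Multiset.exists_cons_of_mem hβ
      have h1 := h β
      rw [Multiset.map_cons, Multiset.sum_cons, map_add, rootForm_corootElt] at h1
      -- The coroot of `β` contributes `2` to a total of at most `1`, so another summand pairs
      -- negatively with `β`. The two cancel or merge into one coroot, and the sum gets shorter.
      have h2 : ∃ δ ∈ T, rootForm H β (corootElt H δ) < 0 := by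
        by_contra! hT
        have : 0 ≤ rootForm H β (T.map (corootElt H)).sum := by
          rw [map_multiset_sum, Multiset.map_map]
          refine Multiset.sum_nonneg fun y hy ↦ ?_
          obtain ⟨δ, hδ, rfl⟩ := Multiset.mem_map.mp hy
          exact hT δ hδ
        linarith
      obtain ⟨δ, hδ, hneg⟩ := h2
      obtain ⟨U, rfl⟩ := Multiset.exists_cons_of_mem hδ
      rw [rootForm_corootElt_eq] at hneg
      simp only [Multiset.card_cons] at hn
      rcases corootElt_add_of_pairingIn_neg (by exact_mod_cast hneg : _ < (0 : ℤ)) with h3 | ⟨θ, h3⟩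
      · have h4 : ((β ::ₘ δ ::ₘ U).map (corootElt H)).sum = (U.map (corootElt H)).sum := by
          simp only [Multiset.map_cons, Multiset.sum_cons]
          rw [← add_assoc, h3, zero_add]
        rw [h4] at h ⊢
        exact ih U.card (by omega) U h rfl
      · have h4 : ((β ::ₘ δ ::ₘ U).map (corootElt H)).sum
            = ((θ ::ₘ U).map (corootElt H)).sum := by
          simp only [Multiset.map_cons, Multiset.sum_cons]
          rw [← add_assoc, h3]
        rw [h4] at h ⊢
        exact ih (θ ::ₘ U).card (by rw [Multiset.card_cons]; omega) (θ ::ₘ U) h rfl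

/-! ### The affine Weyl group -/

/-- The open fundamental alcove, described by all the positive roots. -/
def openAlcove (b : (rootSystem H).Base) : Set (realCartan H) :=
  {x | ∀ φ, b.IsPos φ → 0 < rootForm H φ x ∧ rootForm H φ x < 1}

theorem exists_perm_of_mem_affineWeylGroup {σ : realCartan H ≃ᵃ[ℝ] realCartan H}
    (hσ : σ ∈ affineWeylGroup H) : ∃ (π : Equiv.Perm H.root) (n : H.root → ℤ),
      ∀ φ x, rootForm H φ (σ x) = n φ + rootForm H (π φ) x := by
  obtain ⟨γ, hγ, w, hw, h⟩ := hσ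
  obtain ⟨π, hπ, -⟩ := exists_perm_of_mem_weylGroup hw
  choose n hn using exists_int_rootForm hγ
  exact ⟨π, n, fun φ x ↦ by rw [h, map_add, hπ, hn]⟩

theorem abs_rootForm_lt_one_of_mem_openAlcove {b : (rootSystem H).Base} {x : realCartan H}
    (hx : x ∈ openAlcove b) (φ : H.root) : -1 < rootForm H φ x ∧ rootForm H φ x < 1 := by
  rcases isPos_or_isPos_negRoot b φ with h | h
  · have := hx φ h
    constructor <;> linarith
  · have := hx _ h
    rw [rootForm_negRoot] at this
    constructor <;> linarith

/-- The affine Weyl group acts freely on the union of the open alcoves. -/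
theorem affineWeyl_eq_one {b : (rootSystem H).Base} {σ : realCartan H ≃ᵃ[ℝ] realCartan H}
    (hσ : σ ∈ affineWeylGroup H) {x : realCartan H} (hx : x ∈ openAlcove b)
    (hσx : σ x ∈ openAlcove b) : σ = 1 := by
  obtain ⟨γ, hγ, w, hw, h⟩ := hσ
  obtain ⟨π, hπ, -⟩ := exists_perm_of_mem_weylGroup hw
  -- The integer `φ(γ)` is the difference of a number in `(0, 1)` and one in `(-1, 1)`, so it is `0`
  -- or `1`. Thus `γ` is minuscule, hence zero, which leaves the linear case.
  have hpos : ∀ φ, b.IsPos φ → 0 ≤ rootForm H φ γ ∧ rootForm H φ γ ≤ 1 := by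
    intro φ hφ
    obtain ⟨n, hn⟩ := exists_int_rootForm hγ φ
    have h1 := hσx φ hφ
    have h2 := abs_rootForm_lt_one_of_mem_openAlcove hx (π φ)
    rw [h, map_add, hπ, hn] at h1
    have h3 : -1 < n := by
      have : (-1 : ℝ) < n := by linarith
      exact_mod_cast this
    have h4 : n < 2 := by
      have : (n : ℝ) < 2 := by linarith
      exact_mod_cast this
    rw [hn]
    constructor
    · exact_mod_cast (by omega : 0 ≤ n)
    · exact_mod_cast (by omega : n ≤ 1)
  have hγ0 : γ = 0 := by
    refine eq_zero_of_mem_corootLattice hγ fun φ ↦ ?_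
    rcases isPos_or_isPos_negRoot b φ with hφ | hφ
    · exact (hpos φ hφ).2
    · have := hpos _ hφ
      rw [rootForm_negRoot] at this
      linarith
  have hw1 : w = 1 := by
    refine weyl_eq_one_of_strictlyDominant (fun φ hφ ↦ (hx φ hφ).1) hw fun φ hφ ↦ ?_
    have := (hσx φ hφ).1
    rwa [h, hγ0, zero_add] at this
  ext1 y
  rw [h, hγ0, hw1, zero_add]
  rfl

end

section

/-! ### The highest root -/

variable (b : (rootSystem H).Base)

theorem height_le_highestRoot (φ : H.root) : b.height φ ≤ b.height (highestRoot b) :=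
  (exists_highest b).choose_spec φ

theorem isPos_highestRoot : b.IsPos (highestRoot b) := by
  have h := height_le_highestRoot b (highestRoot b)
  rcases isPos_or_isPos_negRoot b (highestRoot b) with h1 | h1
  · exact h1
  · exact lt_of_lt_of_le h1 (height_le_highestRoot b _)

variable {b}

theorem pairingIn_nonneg_of_forall_add_notMem {φ : H.root} (hφ : b.IsPos φ) {i : H.root}
    (hi : i ∈ b.support)
    (h : (rootSystem H).root φ + (rootSystem H).root i ∉ Set.range (rootSystem H).root) :
    0 ≤ (rootSystem H).pairingIn ℤ φ i := by
  by_contra! hneg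
  refine h ((rootSystem H).root_add_root_mem_of_pairingIn_neg hneg fun h0 ↦ ?_)
  rw [← root_negRoot] at h0
  have h1 := (rootSystem H).root.injective h0
  have h2 := b.isPos_of_mem_support hi
  rw [h1, isPos_negRoot] at hφ
  exact hφ h2

theorem rootForm_rootElt_nonneg_iff (φ α : H.root) :
    0 ≤ rootForm H φ (rootElt H α) ↔ 0 ≤ (rootSystem H).pairingIn ℤ φ α := by
  have h := rootForm_rootElt φ α
  have hpos := rootForm_rootElt_self_pos α
  rw [← Int.cast_nonneg_iff (R := ℝ)]
  constructor
  · intro h1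
    by_contra! h2
    have := mul_neg_of_pos_of_neg hpos h2
    linarith
  · intro h1
    have := mul_nonneg hpos.le h1
    linarith

theorem rootForm_rootElt_pos_iff (φ α : H.root) :
    0 < rootForm H φ (rootElt H α) ↔ 0 < (rootSystem H).pairingIn ℤ φ α := by
  have h := rootForm_rootElt φ α
  have hpos := rootForm_rootElt_self_pos α
  rw [← Int.cast_pos (R := ℝ)]
  constructor
  · intro h1
    by_contra! h2
    have := mul_nonpos_of_nonneg_of_nonpos hpos.le h2
    linarith
  · intro h1
    have := mul_pos hpos h1
    linarith

variable (b)

theorem pairingIn_highestRoot_nonneg {i : H.root} (hi : i ∈ b.support) :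
    0 ≤ (rootSystem H).pairingIn ℤ (highestRoot b) i := by
  refine pairingIn_nonneg_of_forall_add_notMem (isPos_highestRoot b) hi ?_
  rintro ⟨θ, hθ⟩
  have h1 := b.height_add hθ
  have h2 := height_le_highestRoot b θ
  rw [RootPairing.Base.height_one_of_mem_support hi] at h1
  omega

theorem rootForm_rootElt_highestRoot_nonneg {i : H.root} (hi : i ∈ b.support) :
    0 ≤ rootForm H i (rootElt H (highestRoot b)) := by
  rw [rootForm_rootElt_comm, rootForm_rootElt_nonneg_iff]
  exact pairingIn_highestRoot_nonneg b hi

/-- All the simple roots occur in the highest root. -/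
theorem exists_highestRoot_eq_sum : ∃ f : H.root → ℕ, (∀ i ∈ b.support, f i ≠ 0) ∧
    (rootSystem H).root (highestRoot b)
      = ∑ i ∈ b.support, (f i : ℤ) • (rootSystem H).root i := by
  obtain ⟨f, ⟨i, hi, hfi⟩, -, h⟩ := exists_nat_coeff (isPos_highestRoot b)
  refine ⟨f, fun j hj ↦ ?_, h⟩
  -- The Dynkin diagram is connected, so it suffices to pass from a node to its neighbours: if `k`
  -- occurs in `ψ` and a neighbour `l` did not, then `ψ` would pair negatively with the coroot of
  -- `l`.
  refine RootPairing.Base.induction_on_cartanMatrix b (fun k ↦ f k.1 ≠ 0) (i := ⟨i, hi⟩)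
    (j := ⟨j, hj⟩) hfi ?_
  rintro k l hk hkl h0
  have hlk : (rootSystem H).pairingIn ℤ k l ≠ 0 := by
    intro h1
    exact hkl ((RootPairing.Base.cartanMatrix_apply_eq_zero_iff_symm b).mp h1)
  have hne : k.1 ≠ l.1 := fun h1 ↦ hk (by rw [h1]; exact h0)
  have h2 := rootForm_eq_sum _ _ (fun i ↦ i) h (corootElt H l.1)
  have h3 : ∀ m ∈ b.support, ((f m : ℤ) : ℝ) * rootForm H m (corootElt H l.1) ≤ 0 := by
    intro m hm
    by_cases hml : m = l.1
    · rw [hml, h0]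
      simp
    · refine mul_nonpos_of_nonneg_of_nonpos (by simp) ?_
      rw [rootForm_corootElt_eq]
      exact_mod_cast b.pairingIn_le_zero_of_ne hml hm l.2
  have h4 : ((f k.1 : ℤ) : ℝ) * rootForm H k.1 (corootElt H l.1) < 0 := by
    refine mul_neg_of_pos_of_neg ?_ ?_
    · exact_mod_cast Nat.pos_of_ne_zero hk
    · rw [rootForm_corootElt_eq]
      exact_mod_cast lt_of_le_of_ne (b.pairingIn_le_zero_of_ne hne k.2 l.2) hlk
  have h5 : ∑ m ∈ b.support, ((f m : ℤ) : ℝ) * rootForm H m (corootElt H l.1) < 0 :=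
    Finset.sum_neg' h3 ⟨k.1, k.2, h4⟩
  have h6 := pairingIn_highestRoot_nonneg b l.2
  rw [← h2, rootForm_corootElt_eq] at h5
  have h7 : (rootSystem H).pairingIn ℤ (highestRoot b) l.1 < 0 := by exact_mod_cast h5
  omega

/-- Some simple root pairs strictly positively with `φ`, as otherwise `(φ, φ) ≤ 0`; and that simple
root occurs in `ψ`, whose other terms contribute nonnegatively. -/
theorem rootForm_highestRoot_pos_of_dominant {φ : H.root} (hφ : b.IsPos φ)
    (h : ∀ i ∈ b.support, 0 ≤ (rootSystem H).pairingIn ℤ φ i) :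
    0 < rootForm H (highestRoot b) (rootElt H φ) := by
  have hnn : ∀ i ∈ b.support, 0 ≤ rootForm H i (rootElt H φ) := fun i hi ↦ by
    rw [rootForm_rootElt_comm, rootForm_rootElt_nonneg_iff]
    exact h i hi
  obtain ⟨f, hf, hsum⟩ := exists_highestRoot_eq_sum b
  have hex : ∃ i ∈ b.support, 0 < rootForm H i (rootElt H φ) := by
    by_contra! hcon
    obtain ⟨g, -, -, hg⟩ := exists_nat_coeff hφ
    have h1 := rootForm_rootElt_self_pos φ
    rw [rootForm_eq_sum _ _ (fun i ↦ i) hg] at h1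
    refine absurd h1 (not_lt.mpr (Finset.sum_nonpos fun i hi ↦ ?_))
    exact mul_nonpos_of_nonneg_of_nonpos (by simp) (hcon i hi)
  obtain ⟨i, hi, hpos⟩ := hex
  rw [rootForm_eq_sum _ _ (fun i ↦ i) hsum]
  refine Finset.sum_pos' (fun j hj ↦ mul_nonneg (by simp) (hnn j hj)) ⟨i, hi, mul_pos ?_ hpos⟩
  exact_mod_cast Nat.pos_of_ne_zero (hf i hi)

variable {b}

/-- The highest root dominates every root on the closed Weyl chamber. -/
theorem rootForm_le_highestRoot {x : realCartan H} (hx : ∀ i ∈ b.support, 0 ≤ rootForm H i x)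
    (φ : H.root) : rootForm H φ x ≤ rootForm H (highestRoot b) x := by
  by_cases hpos : b.IsPos φ
  · induction hn : (b.height (highestRoot b) - b.height φ).toNat using Nat.strong_induction_on
      generalizing φ with
    | _ n ih =>
      -- Climb by adding simple roots, which can only increase the value at `x`. When no step is
      -- possible `φ` is dominant, so it pairs positively with `ψ`; then `ψ - φ` is zero or a root,
      -- and in the latter case positive by maximality of the height of `ψ`.
      by_cases hadd : ∃ i ∈ b.support, (rootSystem H).root φ + (rootSystem H).root i
          ∈ Set.range (rootSystem H).root
      · obtain ⟨i, hi, θ, hθ⟩ := hadd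
        have h1 := b.height_add hθ
        have h2 := height_le_highestRoot b θ
        rw [RootPairing.Base.height_one_of_mem_support hi] at h1
        have h3 := ih _ (by omega) θ (hpos.add (b.isPos_of_mem_support hi) hθ) rfl
        have h4 := rootForm_add hθ x
        have h5 := hx i hi
        linarith
      · push Not at hadd
        have h1 := rootForm_highestRoot_pos_of_dominant b hpos fun i hi ↦
          pairingIn_nonneg_of_forall_add_notMem hpos hi (hadd i hi)
        rw [rootForm_rootElt_pos_iff] at h1
        by_cases heq : highestRoot b = φ
        · rw [heq]
        · obtain ⟨θ, hθ⟩ := (rootSystem H).root_sub_root_mem_of_pairingIn_pos h1 heq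
          have h2 := b.height_sub hθ
          have h3 := height_le_highestRoot b φ
          have h4 : b.IsPos θ := by
            rw [RootPairing.Base.isPos_iff']
            omega
          have h5 := rootForm_nonneg_of_simple hx h4
          have h6 := rootForm_add (φ := highestRoot b) (α := θ) (β := φ)
            (by rw [hθ, sub_add_cancel]) x
          linarith
  · have h1 := rootForm_nonneg_of_simple hx ((isPos_negRoot b φ).mpr hpos)
    have h2 := rootForm_nonneg_of_simple hx (isPos_highestRoot b)
    rw [rootForm_negRoot] at h1
    linarith

theorem mem_openAlcove_of_simple {x : realCartan H} (hx : ∀ i ∈ b.support, 0 < rootForm H i x)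
    (hψ : rootForm H (highestRoot b) x < 1) : x ∈ openAlcove b := fun φ hφ ↦
  ⟨rootForm_pos_of_simple hx hφ,
    (rootForm_le_highestRoot (fun i hi ↦ (hx i hi).le) φ).trans_lt hψ⟩

/-! ### Twice the half sum of the positive roots lies in the open fundamental alcove -/

open Classical in
theorem sum_eq_sum_pos {M : Type*} [AddCommMonoid M] (b : (rootSystem H).Base)
    (f : H.root → M) :
    ∑ α, f α = ∑ α ∈ Finset.univ.filter (b.IsPos ·), (f α + f (negRoot α)) := by
  rw [← Finset.sum_filter_add_sum_filter_not _ (b.IsPos ·), Finset.sum_add_distrib]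
  congr 1
  refine Finset.sum_nbij' negRoot negRoot ?_ ?_ ?_ ?_ ?_
  · intro a ha
    simpa [isPos_negRoot] using ha
  · intro a ha
    simpa [isPos_negRoot] using ha
  · exact fun a _ ↦ negRoot_negRoot a
  · exact fun a _ ↦ negRoot_negRoot a
  · exact fun a _ ↦ by rw [negRoot_negRoot]

variable (b) in
/-- The sum `2ρ` of the positive roots. -/
def twoRho : realCartan H := (2 : ℝ) • rho b

open Classical in
theorem twoRho_eq : twoRho b = ∑ α ∈ Finset.univ.filter (b.IsPos ·), rootElt H α := by
  rw [twoRho, rho, smul_smul]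
  norm_num
  rfl

open Classical in
theorem rootForm_twoRho (φ : H.root) :
    rootForm H φ (twoRho b)
      = ∑ α ∈ Finset.univ.filter (b.IsPos ·), rootForm H φ (rootElt H α) := by
  rw [twoRho_eq, map_sum]

/-- The reflection `s_i` permutes the positive roots other than `α_i` and changes the sign of their
product with `α_i`, so these terms cancel and only `α_i` is left. -/
theorem rootForm_twoRho_simple {i : H.root} (hi : i ∈ b.support) :
    rootForm H i (twoRho b) = rootForm H i (rootElt H i) := by
  classical
  have hmem : i ∈ Finset.univ.filter (b.IsPos ·) := by
    simpa using b.isPos_of_mem_support hi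
  rw [rootForm_twoRho, ← Finset.add_sum_erase _ _ hmem, add_eq_left]
  have href : ∀ α, rootForm H i (rootElt H ((rootSystem H).reflectionPerm i α))
      = -rootForm H i (rootElt H α) := fun α ↦ by
    rw [← rootReflection_rootElt, ← rootForm_reflectionPerm]
    exact rootForm_negRoot i _
  refine Finset.sum_involution (fun α _ ↦ (rootSystem H).reflectionPerm i α) ?_ ?_ ?_ ?_
  · intro α _
    rw [href, add_neg_cancel]
  · intro α _ h0 h1
    have := href α
    rw [h1] at this
    exact h0 (by linarith)
  · intro α hα
    simp only [Finset.mem_erase, Finset.mem_filter, Finset.mem_univ, true_and] at hα ⊢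
    refine ⟨fun h1 ↦ ?_, hα.2.reflectionPerm hi hα.1⟩
    have h2 : α = negRoot i := by
      rw [← reflectionPerm_reflectionPerm i α, h1]
      rfl
    rw [h2, isPos_negRoot] at hα
    exact hα.2 (b.isPos_of_mem_support hi)
  · exact fun α _ ↦ reflectionPerm_reflectionPerm i α

/-- If the pairing `p` were at least `2`, the root `pψ - α`, the negative of the reflected one,
would have height at least `2 ht ψ - ht α`, forcing `ht α ≥ ht ψ`. But `α - ψ` is then a root, so
the heights differ and `ht α < ht ψ`. -/
theorem pairingIn_highestRoot_mem {α : H.root} (hα : b.IsPos α) (hne : α ≠ highestRoot b) :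
    (rootSystem H).pairingIn ℤ α (highestRoot b) = 0 ∨
      (rootSystem H).pairingIn ℤ α (highestRoot b) = 1 := by
  have h0 : 0 ≤ (rootSystem H).pairingIn ℤ α (highestRoot b) := by
    rw [← rootForm_rootElt_nonneg_iff]
    exact rootForm_nonneg_of_simple (fun i hi ↦ rootForm_rootElt_highestRoot_nonneg b hi) hα
  by_contra! h
  obtain ⟨θ, hθ⟩ := (rootSystem H).root_sub_root_mem_of_pairingIn_pos
    (i := α) (j := highestRoot b) (by omega) hne
  have h1 := b.height_sub hθ
  have h2 := b.height_ne_zero θ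
  have h3 := height_le_highestRoot b α
  have h4 := root_reflectionPerm_eq α (highestRoot b)
  rw [sub_eq_add_neg, ← neg_smul] at h4
  have h5 := b.height_add_zsmul h4
  have h6 := height_le_highestRoot b (negRoot ((rootSystem H).reflectionPerm (highestRoot b) α))
  rw [height_negRoot, h5, smul_eq_mul] at h6
  have h7 : 0 < b.height (highestRoot b) := isPos_highestRoot b
  have h8 : 2 ≤ (rootSystem H).pairingIn ℤ α (highestRoot b) := by omega
  have h9 : b.height α < b.height (highestRoot b) := by omega
  have h10 := mul_nonneg (sub_nonneg.mpr h8) h7.le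
  linarith

/-- The Casimir element acts by `1` on the adjoint representation. -/
theorem rootForm_highestRoot_twoRho :
    rootForm H (highestRoot b) (rootElt H (highestRoot b))
      + rootForm H (highestRoot b) (twoRho b) = 1 := by
  classical
  set ψ := highestRoot b with hψ
  set c := rootForm H ψ (rootElt H ψ) with hc
  have hcpos : 0 < c := rootForm_rootElt_self_pos ψ
  have hmem : ψ ∈ Finset.univ.filter (b.IsPos ·) := by
    simpa using isPos_highestRoot b
  -- The Killing norm of `ψ` is itself a sum of squares over all roots, and opposite roots give
  -- equal terms.
  have h1 : c = ∑ α ∈ Finset.univ.filter (b.IsPos ·),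
      2 * (rootForm H α (rootElt H ψ) * rootForm H α (rootElt H ψ)) := by
    rw [hc, ← killing_rootElt ψ, killing, sum_eq_sum_pos b]
    refine Finset.sum_congr rfl fun α _ ↦ ?_
    rw [rootForm_negRoot]
    ring
  -- Here `(α, ψ)` is `0` or `c/2`, so the quadratic term is linear in `(α, ψ)`. Only `α = ψ` is
  -- exceptional, which produces the extra `c` in the identity after division by `c`.
  have h2 : ∀ α ∈ (Finset.univ.filter (b.IsPos ·)).erase ψ,
      2 * (rootForm H α (rootElt H ψ) * rootForm H α (rootElt H ψ))
        = c * rootForm H ψ (rootElt H α) := by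
    intro α hα
    simp only [Finset.mem_erase, Finset.mem_filter, Finset.mem_univ, true_and] at hα
    have h3 := rootForm_rootElt α ψ
    rw [rootForm_rootElt_comm ψ α]
    rcases pairingIn_highestRoot_mem hα.2 hα.1 with h | h <;> rw [h] at h3 <;> push_cast at h3
    · have : rootForm H α (rootElt H ψ) = 0 := by linarith
      rw [this]
      ring
    · have : c = 2 * rootForm H α (rootElt H ψ) := by rw [hc]; linarith
      rw [this]
      ring
  rw [← Finset.add_sum_erase _ _ hmem, Finset.sum_congr rfl h2, ← Finset.mul_sum] at h1
  have h4 := rootForm_twoRho (b := b) ψ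
  rw [← Finset.add_sum_erase _ _ hmem] at h4
  rw [h4, ← hc]
  rw [← hc] at h1
  apply mul_left_cancel₀ hcpos.ne'
  linear_combination -h1

theorem twoRho_mem_openAlcove : twoRho b ∈ openAlcove b := by
  refine mem_openAlcove_of_simple (fun i hi ↦ ?_) ?_
  · rw [rootForm_twoRho_simple hi]
    exact rootForm_rootElt_self_pos i
  · have h1 := rootForm_highestRoot_twoRho (b := b)
    have h2 := rootForm_rootElt_self_pos (highestRoot b)
    linarith

end

section

/-! ### The weight of an alcove -/

variable {b : (rootSystem H).Base}

theorem rootForm_ne_int_of_mem_openAlcove {x : realCartan H} (hx : x ∈ openAlcove b) (φ : H.root)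
    (n : ℤ) : rootForm H φ x ≠ n := by
  intro h
  have h1 := abs_rootForm_lt_one_of_mem_openAlcove hx φ
  rw [h] at h1
  have h2 : -1 < n := by exact_mod_cast h1.1
  have h3 : n < 1 := by exact_mod_cast h1.2
  have h4 : n = 0 := by omega
  rw [h4, Int.cast_zero] at h
  rcases isPos_or_isPos_negRoot b φ with h5 | h5
  · exact (hx φ h5).1.ne' h
  · have := (hx _ h5).1
    rw [rootForm_negRoot, h, neg_zero] at this
    exact lt_irrefl _ this

theorem rootForm_affine_ne_int {σ : realCartan H ≃ᵃ[ℝ] realCartan H}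
    (hσ : σ ∈ affineWeylGroup H) {x : realCartan H} (hx : x ∈ openAlcove b) (φ : H.root)
    (n : ℤ) : rootForm H φ (σ x) ≠ n := by
  obtain ⟨π, m, h⟩ := exists_perm_of_mem_affineWeylGroup hσ
  rw [h]
  intro h1
  refine rootForm_ne_int_of_mem_openAlcove hx (π φ) (n - m φ) ?_
  push_cast
  linarith

theorem floor_lt_rootForm_affine {σ : realCartan H ≃ᵃ[ℝ] realCartan H}
    (hσ : σ ∈ affineWeylGroup H) {x : realCartan H} (hx : x ∈ openAlcove b) (φ : H.root) :
    (⌊rootForm H φ (σ x)⌋ : ℝ) < rootForm H φ (σ x) :=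
  lt_of_le_of_ne (Int.floor_le _) (rootForm_affine_ne_int hσ hx φ _).symm

/-- The sum `∑ ⌊(α, y)⌋ α` over all the roots. -/
def floorSum (y : realCartan H) : realCartan H :=
  ∑ α : H.root, (⌊rootForm H α y⌋ : ℝ) • rootElt H α

/-- The integers `α(γ)` come out of the floors and sum to `∑ α(γ) α = γ`; the linear part only
reindexes the roots. -/
theorem floorSum_affine {σ : realCartan H ≃ᵃ[ℝ] realCartan H} (hσ : σ ∈ affineWeylGroup H)
    (y : realCartan H) : floorSum (σ y) = σ (floorSum y) := by
  obtain ⟨γ, hγ, w, hw, h⟩ := hσ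
  obtain ⟨π, hπ, hπ'⟩ := exists_perm_of_mem_weylGroup hw
  have h1 : ∀ α, (⌊rootForm H α (σ y)⌋ : ℝ)
      = rootForm H α γ + (⌊rootForm H (π α) y⌋ : ℝ) := by
    intro α
    obtain ⟨n, hn⟩ := exists_int_rootForm hγ α
    rw [h, map_add, hπ, hn, Int.floor_intCast_add]
    push_cast
    rfl
  have h2 : ∑ α : H.root, (⌊rootForm H (π α) y⌋ : ℝ) • rootElt H α = w (floorSum y) := by
    rw [floorSum, map_sum, ← Equiv.sum_comp π fun α ↦ w ((⌊rootForm H α y⌋ : ℝ) • rootElt H α)]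
    refine Finset.sum_congr rfl fun α _ ↦ ?_
    rw [map_smul, hπ']
  rw [h (floorSum y), ← h2]
  simp only [floorSum, h1, add_smul, Finset.sum_add_distrib]
  rw [sum_rootForm_smul_rootElt]

open Classical in
-- For non-integral `t` one has `⌊-t⌋ = -⌊t⌋ - 1`, so a pair of opposite roots contributes `(2⌊t⌋ +
-- 1)α`.
theorem floorSum_eq {y : realCartan H} (hy : ∀ (φ : H.root) (n : ℤ), rootForm H φ y ≠ n) :
    floorSum y = (2 : ℝ) • (∑ α ∈ Finset.univ.filter (b.IsPos ·),
      (⌊rootForm H α y⌋ : ℝ) • rootElt H α) + twoRho b := by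
  rw [floorSum, sum_eq_sum_pos b, twoRho_eq, Finset.smul_sum, ← Finset.sum_add_distrib]
  refine Finset.sum_congr rfl fun α _ ↦ ?_
  have h1 : ⌊rootForm H (negRoot α) y⌋ = -⌊rootForm H α y⌋ - 1 := by
    rw [rootForm_negRoot, Int.floor_eq_iff]
    have h2 := Int.floor_le (rootForm H α y)
    have h3 := Int.lt_floor_add_one (rootForm H α y)
    have h4 := lt_of_le_of_ne h2 (hy α _).symm
    push_cast
    constructor <;> linarith
  rw [h1, rootElt_negRoot]
  push_cast
  module

theorem floorSum_of_mem_openAlcove {x : realCartan H} (hx : x ∈ openAlcove b) :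
    floorSum x = twoRho b := by
  classical
  rw [floorSum_eq (b := b) (rootForm_ne_int_of_mem_openAlcove hx), add_eq_right]
  convert smul_zero (2 : ℝ)
  refine Finset.sum_eq_zero fun α hα ↦ ?_
  simp only [Finset.mem_filter, Finset.mem_univ, true_and] at hα
  have h1 := hx α hα
  have h2 : ⌊rootForm H α x⌋ = 0 := by
    rw [Int.floor_eq_zero_iff]
    exact ⟨h1.1.le, h1.2⟩
  rw [h2, Int.cast_zero, zero_smul]

open Classical in
/-- The weight `λ^σ` in terms of the position of the alcove of `σ`. -/
theorem alcoveWeight_eq (σ : affineWeylGroup H) :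
    alcoveWeight b σ = ∑ α ∈ Finset.univ.filter (b.IsPos ·),
      (⌊rootForm H α (σ.1 (twoRho b))⌋ : ℝ) • rootElt H α := by
  -- Since `2ρ` is its own floor sum, equivariance presents `σ(2ρ)` as the floor sum at `σ(2ρ)`.
  have h1 := floorSum_affine σ.2 (twoRho b)
  rw [floorSum_of_mem_openAlcove twoRho_mem_openAlcove,
    floorSum_eq (b := b) (rootForm_affine_ne_int σ.2 twoRho_mem_openAlcove)] at h1
  have h2 : alcoveWeight b σ
      = (1 / 2 : ℝ) • σ.1 (twoRho b) - (1 / 2 : ℝ) • twoRho b := by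
    rw [alcoveWeight, twoRho, smul_smul (1 / 2 : ℝ) (2 : ℝ) (rho b)]
    norm_num
  rw [h2]
  linear_combination (norm := module) (-(1 / 2) : ℝ) • h1

/-- The weight remembers `σ(2ρ)`, and `2ρ` is an interior point of the alcove, where the action is
free. -/
theorem alcoveWeight_injective : Function.Injective (alcoveWeight b) := by
  intro σ τ h
  have h1 : σ.1 (twoRho b) = τ.1 (twoRho b) := by
    simp only [alcoveWeight, sub_left_inj] at h
    exact smul_right_injective _ (by norm_num : (1 / 2 : ℝ) ≠ 0) h
  have h2 : τ⁻¹ * σ = 1 := by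
    apply Subtype.ext
    refine affineWeyl_eq_one (τ⁻¹ * σ).2 (twoRho_mem_openAlcove (b := b)) ?_
    have h3 : ((τ⁻¹ * σ : affineWeylGroup H) : realCartan H ≃ᵃ[ℝ] realCartan H) (twoRho b)
        = twoRho b := by
      change τ.1.symm (σ.1 (twoRho b)) = twoRho b
      rw [h1]
      exact τ.1.symm_apply_apply _
    rw [h3]
    exact twoRho_mem_openAlcove
  rw [inv_mul_eq_one] at h2
  exact h2.symm

/-! ### The closed fundamental alcove is a fundamental domain -/

theorem mem_fundamentalAlcove_of_mem_openAlcove {x : realCartan H} (hx : x ∈ openAlcove b) :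
    x ∈ fundamentalAlcove b :=
  ⟨fun i hi ↦ (hx i (b.isPos_of_mem_support hi)).1.le, (hx _ (isPos_highestRoot b)).2.le⟩

theorem killing_corootElt (φ : H.root) :
    ∃ d : ℝ, 0 < d ∧ ∀ x, killing x (corootElt H φ) = d * rootForm H φ x := by
  have hpos := rootForm_rootElt_self_pos φ
  have h1 : corootElt H φ = (2 / rootForm H φ (rootElt H φ)) • rootElt H φ := by
    have h := smul_corootElt φ
    rw [div_eq_inv_mul, mul_smul, ← h, smul_smul, inv_mul_cancel₀ hpos.ne', one_smul]
  have h2 : ∀ x, killing x (corootElt H φ)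
      = 2 / rootForm H φ (rootElt H φ) * rootForm H φ x := fun x ↦ by
    rw [h1, killing_smul_right, killing_comm, killing_rootElt]
  exact ⟨_, by positivity, h2⟩

/-- With `a = φ(x) - n` this compares the distances to `p` of `x` and of its mirror image, taking `u
= x - p`. -/
theorem killing_sub_smul_corootElt (φ : H.root) : ∃ d : ℝ, 0 < d ∧ ∀ (u : realCartan H) (a : ℝ),
    killing (u - a • corootElt H φ) (u - a • corootElt H φ)
      = killing u u + 2 * d * (a * (a - rootForm H φ u)) := by
  obtain ⟨d, hd, h2⟩ := killing_corootElt φ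
  refine ⟨d, hd, fun u a ↦ ?_⟩
  simp only [killing_sub_left, killing_sub_right, killing_smul_left, killing_smul_right, h2,
    killing_comm (corootElt H φ), map_sub, map_smul, smul_eq_mul, rootForm_corootElt]
  ring

theorem rootReflection_mem (φ : H.root) : rootReflection H φ ∈ weylGroup H :=
  Subgroup.subset_closure ⟨φ, rfl⟩

/-- The reflection in the hyperplane `(φ, x) = n` as an element of the affine Weyl group. -/
theorem exists_affineReflection (φ : H.root) (n : ℤ) : ∃ σ ∈ affineWeylGroup H,
    ∀ x, σ x = x - (rootForm H φ x - n) • corootElt H φ := by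
  refine ⟨(rootReflection H φ).toAffineEquiv.trans
    (AffineEquiv.constVAdd ℝ (realCartan H) (n • corootElt H φ)),
    ⟨n • corootElt H φ, zsmul_mem (corootElt_mem φ) n, rootReflection H φ, rootReflection_mem φ,
      fun x ↦ rfl⟩, fun x ↦ ?_⟩
  change n • corootElt H φ + rootReflection H φ x = _
  rw [rootReflection_apply, ← Int.cast_smul_eq_zsmul ℝ]
  module

/-- Each root takes on the orbit values in finitely many translates of `ℤ`, the ball bounds them,
and the roots separate points. -/
theorem finite_orbit_inter_ball (x p : realCartan H) (R : ℝ) :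
    {y | (∃ σ ∈ affineWeylGroup H, y = σ x) ∧ killing (y - p) (y - p) ≤ R}.Finite := by
  obtain ⟨M, hM⟩ : ∃ M : ℝ, ∀ φ θ : H.root, |rootForm H φ p| + |rootForm H θ x| + (R + 1) ≤ M := by
    refine ⟨∑ φ, |rootForm H φ p| + ∑ θ, |rootForm H θ x| + (R + 1), fun φ θ ↦ ?_⟩
    have h1 := Finset.single_le_sum (f := fun φ ↦ |rootForm H φ p|) (fun _ _ ↦ abs_nonneg _)
      (Finset.mem_univ φ)
    have h2 := Finset.single_le_sum (f := fun φ ↦ |rootForm H φ x|) (fun _ _ ↦ abs_nonneg _)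
      (Finset.mem_univ θ)
    linarith
  let T : Set ℝ := (fun q : ℤ × H.root ↦ (q.1 : ℝ) + rootForm H q.2 x) ''
    (Set.Icc ⌊-M⌋ ⌈M⌉ ×ˢ Set.univ)
  have hT : T.Finite := ((Set.finite_Icc _ _).prod Set.finite_univ).image _
  have hfin : (Set.univ.pi fun _ : H.root ↦ T).Finite := Set.Finite.pi fun _ ↦ hT
  refine Set.Finite.of_finite_image (f := fun (y : realCartan H) (φ : H.root) ↦ rootForm H φ y)
    (hfin.subset ?_) fun y _ y' _ h ↦ eq_of_rootForm_eq fun φ ↦ congrFun h φ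
  rintro _ ⟨y, ⟨⟨σ, hσ, rfl⟩, hR⟩, rfl⟩
  rw [Set.mem_univ_pi]
  intro φ
  obtain ⟨π, n, h⟩ := exists_perm_of_mem_affineWeylGroup hσ
  refine ⟨(n φ, π φ), ⟨?_, Set.mem_univ _⟩, (h φ x).symm⟩
  have h1 := sq_rootForm_le_killing φ (σ x - p)
  rw [map_sub, h] at h1
  have h2 : |(n φ : ℝ)| ≤ M := by
    -- A square at most `R` has root at most `R + 1`; this crude bound avoids the square root.
    have h3 : |(n φ + rootForm H (π φ) x) - rootForm H φ p| ≤ R + 1 := by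
      refine abs_le_of_sq_le_sq (by nlinarith) (by nlinarith)
    have h4 := hM φ (π φ)
    have h5 : (n φ : ℝ) = ((n φ + rootForm H (π φ) x) - rootForm H φ p) + rootForm H φ p
        - rootForm H (π φ) x := by ring
    rw [h5]
    refine (abs_sub _ _).trans (le_trans (add_le_add_left (abs_add_le _ _) _) ?_)
    linarith
  rw [abs_le] at h2
  constructor
  · have : (⌊-M⌋ : ℝ) ≤ n φ := (Int.floor_le _).trans h2.1
    exact_mod_cast this
  · have : (n φ : ℝ) ≤ ⌈M⌉ := h2.2.trans (Int.le_ceil _)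
    exact_mod_cast this

/-- The orbit point nearest to `2ρ` is never strictly separated from `2ρ` by a wall, since
reflecting in that wall would bring it closer. -/
theorem exists_affine_mem_fundamentalAlcove (b : (rootSystem H).Base) (x : realCartan H) :
    ∃ σ ∈ affineWeylGroup H, σ x ∈ fundamentalAlcove b := by
  set p := twoRho b with hp
  have hpA : p ∈ openAlcove b := twoRho_mem_openAlcove
  obtain ⟨y, ⟨⟨σ, hσ, rfl⟩, hy⟩, hmin⟩ := Set.exists_min_image _
    (fun y ↦ killing (y - p) (y - p)) (finite_orbit_inter_ball x p (killing (x - p) (x - p)))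
    ⟨x, ⟨1, one_mem _, rfl⟩, le_rfl⟩
  have hmin' : ∀ τ ∈ affineWeylGroup H,
      killing (σ x - p) (σ x - p) ≤ killing (τ (σ x) - p) (τ (σ x) - p) := by
    intro τ hτ
    by_cases hle : killing (τ (σ x) - p) (τ (σ x) - p) ≤ killing (x - p) (x - p)
    · exact hmin _ ⟨⟨τ * σ, mul_mem hτ hσ, rfl⟩, hle⟩
    · exact hy.trans (not_le.mp hle).le
  have key : ∀ (φ : H.root) (n : ℤ),
      0 ≤ (rootForm H φ (σ x) - n) * (rootForm H φ p - n) := by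
    intro φ n
    obtain ⟨τ, hτ, h⟩ := exists_affineReflection φ n
    obtain ⟨d, hd, h1⟩ := killing_sub_smul_corootElt φ
    have h2 := hmin' τ hτ
    rw [h, sub_right_comm, h1, map_sub] at h2
    have h3 : 0 ≤ 2 * d * ((rootForm H φ (σ x) - n) * (rootForm H φ p - n)) := by
      linear_combination h2
    exact nonneg_of_mul_nonneg_right h3 (by linarith)
  refine ⟨σ, hσ, fun i hi ↦ ?_, ?_⟩
  · have h1 := key i 0
    simp only [Int.cast_zero, sub_zero] at h1
    exact nonneg_of_mul_nonneg_left h1 (hpA i (b.isPos_of_mem_support hi)).1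
  · have h1 := key (highestRoot b) 1
    have h2 := (hpA _ (isPos_highestRoot b)).2
    rw [Int.cast_one] at h1
    nlinarith

/-- A point off all the walls can be moved into the open fundamental alcove. -/
theorem exists_affine_mem_openAlcove (b : (rootSystem H).Base) {x : realCartan H}
    (hx : ∀ (φ : H.root) (n : ℤ), rootForm H φ x ≠ n) :
    ∃ σ ∈ affineWeylGroup H, σ x ∈ openAlcove b := by
  obtain ⟨σ, hσ, h1, h2⟩ := exists_affine_mem_fundamentalAlcove b x
  obtain ⟨π, n, h⟩ := exists_perm_of_mem_affineWeylGroup hσ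
  have hne : ∀ (φ : H.root) (m : ℤ), rootForm H φ (σ x) ≠ m := by
    intro φ m hm
    rw [h] at hm
    refine hx (π φ) (m - n φ) ?_
    push_cast
    linarith
  refine ⟨σ, hσ, mem_openAlcove_of_simple (fun i hi ↦ ?_) ?_⟩
  · refine lt_of_le_of_ne (h1 i hi) fun h0 ↦ hne i 0 ?_
    rw [Int.cast_zero]
    exact h0.symm
  · refine lt_of_le_of_ne h2 fun h0 ↦ hne (highestRoot b) 1 ?_
    rw [Int.cast_one]
    exact h0

end

section

/-! ### A theorem of the alternative -/

/-- Gordan's theorem of the alternative, over the rational numbers. -/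
theorem exists_dual_pos_of_no_relation (n : ℕ) {V : Type*} [AddCommGroup V] [Module ℚ V]
    (v : Fin n → V)
    (h : ∀ c : Fin n → ℚ, (∀ i, 0 ≤ c i) → ∑ i, c i • v i = 0 → ∀ i, c i = 0) :
    ∃ f : V →ₗ[ℚ] ℚ, ∀ i, 0 < f (v i) := by
  induction n generalizing V with
  | zero => exact ⟨0, fun i ↦ i.elim0⟩
  | succ n ih =>
    set u := v 0 with hu
    have hu0 : u ≠ 0 := by
      intro h0
      have := h (Fin.cons 1 0) (fun i ↦ by
        refine Fin.cases ?_ (fun j ↦ ?_) i <;> simp) (by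
        rw [Fin.sum_univ_succ]
        simp [← hu, h0]) 0
      simp at this
    have htail : ∀ (t : ℚ) (c : Fin n → ℚ), 0 ≤ t → (∀ i, 0 ≤ c i) →
        t • u + ∑ i, c i • v i.succ = 0 → ∀ i, c i = 0 := by
      intro t c ht hc hsum i
      have := h (Fin.cons t c) (fun i ↦ by
        refine Fin.cases ?_ (fun j ↦ ?_) i
        · simpa using ht
        · simpa using hc j) (by
        rw [Fin.sum_univ_succ]
        simpa using hsum) i.succ
      simpa using this
    by_cases hq : ∀ c : Fin n → ℚ, (∀ i, 0 ≤ c i) →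
        ∑ i, c i • (ℚ ∙ u).mkQ (v i.succ) = 0 → ∀ i, c i = 0
    -- No relation modulo `u`: a functional positive on the images vanishes on `u`, and a large
    -- multiple of it is added to one that is positive on `u`.
    · obtain ⟨f, hf⟩ := ih (fun i ↦ (ℚ ∙ u).mkQ (v i.succ)) hq
      obtain ⟨g, hg⟩ : ∃ g : V →ₗ[ℚ] ℚ, 0 < g u := by
        obtain ⟨g, hg⟩ := Module.exists_dual_forall_apply_ne_zero (K := ℚ) (v := fun _ : Unit ↦ u)
          (fun _ ↦ hu0)
        rcases lt_or_gt_of_ne (hg ()) with h1 | h1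
        · exact ⟨-g, by simpa using h1⟩
        · exact ⟨g, h1⟩
      let N : ℚ := ∑ i : Fin n, |g (v i.succ)| / f ((ℚ ∙ u).mkQ (v i.succ)) + 1
      refine ⟨N • (f ∘ₗ (ℚ ∙ u).mkQ) + g, fun i ↦ ?_⟩
      refine Fin.cases ?_ (fun j ↦ ?_) i
      · have : (ℚ ∙ u).mkQ u = 0 := by simp
        rw [LinearMap.add_apply, LinearMap.smul_apply, LinearMap.comp_apply, ← hu, this]
        simpa using hg
      · have h1 := Finset.single_le_sum
          (f := fun i : Fin n ↦ |g (v i.succ)| / f ((ℚ ∙ u).mkQ (v i.succ)))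
          (fun i _ ↦ div_nonneg (abs_nonneg _) (hf i).le) (Finset.mem_univ j)
        have h2 := hf j
        have h3 : |g (v j.succ)| + f ((ℚ ∙ u).mkQ (v j.succ))
            ≤ N * f ((ℚ ∙ u).mkQ (v j.succ)) := by
          rw [← div_mul_cancel₀ |g (v j.succ)| h2.ne', ← add_one_mul]
          refine mul_le_mul_of_nonneg_right ?_ h2.le
          exact add_le_add_left h1 1
        have h4 := neg_abs_le (g (v j.succ))
        rw [LinearMap.add_apply, LinearMap.smul_apply, LinearMap.comp_apply, smul_eq_mul]
        linarith
    -- A relation modulo `u` makes some `t • u` a nontrivial nonnegative combination of the others,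
    -- with `t > 0` as otherwise there is a forbidden relation. A functional positive on the others
    -- is then positive on `u`.
    · push Not at hq
      obtain ⟨c, hc, hsum, i, hi⟩ := hq
      have hmem : ∑ i, c i • v i.succ ∈ ℚ ∙ u := by
        rw [← Submodule.Quotient.mk_eq_zero, ← Submodule.mkQ_apply, map_sum]
        simpa using hsum
      obtain ⟨t, ht⟩ := Submodule.mem_span_singleton.mp hmem
      have htpos : 0 < t := by
        by_contra! ht0
        exact hi (htail (-t) c (by linarith) hc (by rw [← ht]; module) i)
      obtain ⟨f, hf⟩ := ih (fun i ↦ v i.succ) fun c hc hs ↦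
        htail 0 c le_rfl hc (by rw [hs]; simp)
      refine ⟨f, fun j ↦ ?_⟩
      refine Fin.cases ?_ hf j
      have h1 : t * f u = ∑ i, c i * f (v i.succ) := by
        rw [← smul_eq_mul, ← map_smul, ht, map_sum]
        simp
      have h2 : 0 < t * f u := by
        rw [h1]
        exact Finset.sum_pos' (fun i _ ↦ mul_nonneg (hc i) (hf i).le)
          ⟨i, Finset.mem_univ _, mul_pos (lt_of_le_of_ne (hc i) (Ne.symm hi)) (hf i)⟩
      exact pos_of_mul_pos_right h2 htpos.le

/-! ### Points with prescribed integral parts -/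

theorem pairingIn_add {φ α β : H.root}
    (h : (rootSystem H).root φ = (rootSystem H).root α + (rootSystem H).root β) (θ : H.root) :
    (rootSystem H).pairingIn ℤ φ θ
      = (rootSystem H).pairingIn ℤ α θ + (rootSystem H).pairingIn ℤ β θ := by
  have := rootForm_add h (corootElt H θ)
  simp only [rootForm_corootElt_eq] at this
  exact_mod_cast this

theorem pairingIn_negRoot (φ θ : H.root) :
    (rootSystem H).pairingIn ℤ (negRoot φ) θ = -(rootSystem H).pairingIn ℤ φ θ := by
  have := rootForm_negRoot φ (corootElt H θ)
  simp only [rootForm_corootElt_eq] at this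
  exact_mod_cast this

/-- A vanishing sum of roots can be contracted by adding up pairs of roots, so a superadditive
function is negative on it. -/
theorem sum_neg_of_superadditive {k : H.root → ℤ} (hneg : ∀ α, k (negRoot α) = -k α - 1)
    (hadd : ∀ φ α β, (rootSystem H).root φ = (rootSystem H).root α + (rootSystem H).root β →
      k α + k β ≤ k φ) (S : Multiset H.root) (hS : S ≠ 0)
    (hsum : ∀ θ, (S.map fun α ↦ (rootSystem H).pairingIn ℤ α θ).sum = 0) :
    (S.map k).sum < 0 := by
  induction hn : S.card using Nat.strong_induction_on generalizing S with
  | _ n ih =>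
    obtain ⟨β, hβ⟩ := Multiset.exists_mem_of_ne_zero hS
    obtain ⟨T, rfl⟩ := Multiset.exists_cons_of_mem hβ
    have h1 := hsum β
    rw [Multiset.map_cons, Multiset.sum_cons, RootPairing.pairingIn_same] at h1
    -- The root `β` pairs to `2` with its own coroot and the total is zero. An opposite pair `β, -β`
    -- contributes `-1` to the `k`-sum and is removed; any other such pair merges into a root
    -- without lowering the `k`-sum.
    have h2 : ∃ δ ∈ T, (rootSystem H).pairingIn ℤ δ β < 0 := by
      by_contra! hT
      have : 0 ≤ (T.map fun α ↦ (rootSystem H).pairingIn ℤ α β).sum := by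
        refine Multiset.sum_nonneg fun y hy ↦ ?_
        obtain ⟨δ, hδ, rfl⟩ := Multiset.mem_map.mp hy
        exact hT δ hδ
      omega
    obtain ⟨δ, hδ, hlt⟩ := h2
    obtain ⟨U, rfl⟩ := Multiset.exists_cons_of_mem hδ
    simp only [Multiset.card_cons] at hn
    simp only [Multiset.map_cons, Multiset.sum_cons] at hsum ⊢
    by_cases hopp : (rootSystem H).root δ = -(rootSystem H).root β
    · have hδ' : δ = negRoot β := by
        apply (rootSystem H).root.injective
        rw [hopp, root_negRoot]
      subst hδ'
      have h3 : ∀ θ, (U.map fun α ↦ (rootSystem H).pairingIn ℤ α θ).sum = 0 := fun θ ↦ by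
        have := hsum θ
        rw [pairingIn_negRoot] at this
        omega
      have h4 := hneg β
      by_cases hU : U = 0
      · subst hU
        simp only [Multiset.map_zero, Multiset.sum_zero]
        omega
      · have := ih U.card (by omega) U hU h3 rfl
        omega
    · obtain ⟨θ, hθ⟩ := (rootSystem H).root_add_root_mem_of_pairingIn_neg hlt hopp
      have h3 := ih (θ ::ₘ U).card (by rw [Multiset.card_cons]; omega) (θ ::ₘ U)
        (Multiset.cons_ne_zero) (fun φ ↦ by
          rw [Multiset.map_cons, Multiset.sum_cons, pairingIn_add hθ, ← hsum φ]
          ring) rfl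
      rw [Multiset.map_cons, Multiset.sum_cons] at h3
      have h4 := hadd θ δ β hθ
      omega

/-! ### Coordinates given by the simple roots -/

instance : FiniteDimensional ℝ (realCartan H) :=
  FiniteDimensional.span_of_finite ℝ (Set.finite_range _)

theorem eq_zero_of_rootForm_simple {b : (rootSystem H).Base} {x : realCartan H}
    (h : ∀ i ∈ b.support, rootForm H i x = 0) : x = 0 := by
  refine eq_zero_of_rootForm_eq_zero fun φ ↦ ?_
  obtain ⟨f, -, -, hf⟩ := b.exists_root_eq_sum_int φ
  rw [rootForm_eq_sum _ _ (fun i ↦ i) hf]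
  exact Finset.sum_eq_zero fun i hi ↦ by rw [h i hi, mul_zero]

theorem linearIndependent_corootElt (b : (rootSystem H).Base) :
    LinearIndependent ℝ fun i : b.support ↦ corootElt H i.1 := by
  refine LinearIndependent.of_comp (realCartan H).subtype ?_
  exact LinearIndependent.restrict_scalars' ℝ b.linearIndepOn_coroot

/-- The simple roots separate points and the simple coroots are independent, so the evaluation map
is injective between spaces of equal dimension. -/
theorem exists_rootForm_simple_eq (b : (rootSystem H).Base) (v : b.support → ℝ) :
    ∃ x : realCartan H, ∀ i : b.support, rootForm H i.1 x = v i := by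
  let L : realCartan H →ₗ[ℝ] (b.support → ℝ) := LinearMap.pi fun i ↦ rootForm H i.1
  have hL : Function.Injective L := by
    rw [← LinearMap.ker_eq_bot, LinearMap.ker_eq_bot']
    exact fun x hx ↦ eq_zero_of_rootForm_simple fun i hi ↦ congrFun hx ⟨i, hi⟩
  have hdim : finrank ℝ (realCartan H) = finrank ℝ (b.support → ℝ) := by
    refine le_antisymm (LinearMap.finrank_le_finrank_of_injective hL) ?_
    rw [finrank_fintype_fun_eq_card]
    exact (linearIndependent_corootElt b).fintype_card_le_finrank
  obtain ⟨x, hx⟩ := (LinearMap.injective_iff_surjective_of_finrank_eq_finrank hdim).mp hL v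
  exact ⟨x, fun i ↦ congrFun hx i⟩

/-- A superadditive integral function on the roots is the integral part of a point. -/
theorem exists_floor_eq (b : (rootSystem H).Base) {k : H.root → ℤ}
    (hneg : ∀ α, k (negRoot α) = -k α - 1)
    (hadd : ∀ φ α β, (rootSystem H).root φ = (rootSystem H).root α + (rootSystem H).root β →
      k α + k β ≤ k φ) :
    ∃ x : realCartan H, ∀ α, (k α : ℝ) < rootForm H α x ∧ rootForm H α x < k α + 1 := by
  -- Roots are encoded by their Cartan integers to work over `ℚ`, where denominators can be cleared;
  -- the extra coordinate `-k α` homogenizes the affine inequalities `k α < α(x)`.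
  let g : H.root → (H.root → ℚ) := fun α θ ↦ ((rootSystem H).pairingIn ℤ α θ : ℚ)
  obtain ⟨f, hf⟩ : ∃ f : ((H.root → ℚ) × ℚ) →ₗ[ℚ] ℚ, ∀ α, 0 < f (g α, -(k α : ℚ)) := by
    let e := Fintype.equivFin H.root
    obtain ⟨f, hf⟩ := exists_dual_pos_of_no_relation (Fintype.card H.root)
      (fun i ↦ (g (e.symm i), -(k (e.symm i) : ℚ))) (by
        intro c hc hsum
        by_contra! hne
        obtain ⟨i, hi⟩ := hne
        obtain ⟨N, hN, hNc⟩ : ∃ N : ℕ, 0 < N ∧ ∀ i, ∃ m : ℕ, (m : ℚ) = N * c i := by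
          refine ⟨∏ i, (c i).den, Finset.prod_pos fun i _ ↦ (c i).den_pos, fun i ↦ ?_⟩
          refine ⟨(∏ j ∈ Finset.univ.erase i, (c j).den) * (c i).num.toNat, ?_⟩
          have h1 : ((c i).num.toNat : ℚ) = (c i).den * c i := by
            have h2 : ((c i).num.toNat : ℤ) = (c i).num :=
              Int.toNat_of_nonneg (Rat.num_nonneg.mpr (hc i))
            rw [Rat.den_mul_eq_num]
            exact_mod_cast h2
          rw [← Finset.mul_prod_erase _ _ (Finset.mem_univ i)]
          push_cast
          rw [h1]
          ring
        choose m hm using hNc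
        -- Taken with multiplicities `N c_j`, the roots form a nonempty multiset with zero sum and
        -- zero `k`-sum, against `sum_neg_of_superadditive`.
        let S : Multiset H.root := ∑ j, m j • ({e.symm j} : Multiset H.root)
        have hSmap : ∀ F : H.root → ℤ, (((S.map F).sum : ℤ) : ℚ)
            = N * ∑ j, c j * (F (e.symm j) : ℚ) := by
          intro F
          have h1 : (S.map F).sum = ∑ j, (m j : ℤ) * F (e.symm j) := by
            have h2 : ∀ T : Multiset H.root, (T.map F).sum
                = (Multiset.sumAddMonoidHom.comp (Multiset.mapAddMonoidHom F)) T := fun _ ↦ rfl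
            rw [h2, map_sum]
            refine Finset.sum_congr rfl fun j _ ↦ ?_
            rw [map_nsmul, ← h2]
            simp
          rw [h1, Finset.mul_sum]
          push_cast
          exact Finset.sum_congr rfl fun j _ ↦ by rw [hm, mul_assoc]
        have hS : S ≠ 0 := by
          intro h0
          have h1 := hSmap fun _ ↦ 1
          rw [h0] at h1
          simp only [Multiset.map_zero, Multiset.sum_zero, Int.cast_zero, Int.cast_one,
            mul_one] at h1
          have h2 : 0 < ∑ j, c j := Finset.sum_pos' (fun j _ ↦ hc j)
            ⟨i, Finset.mem_univ _, lt_of_le_of_ne (hc i) (Ne.symm hi)⟩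
          have h3 : (0 : ℚ) < N := by exact_mod_cast hN
          exact (mul_pos h3 h2).ne h1
        have h1 : ∑ j, c j • g (e.symm j) = 0 := by
          have := congrArg Prod.fst hsum
          rw [Prod.fst_sum] at this
          exact this
        have h2 : ∑ j, c j * (k (e.symm j) : ℚ) = 0 := by
          have := congrArg Prod.snd hsum
          rw [Prod.snd_sum] at this
          simpa using this
        have h3 := sum_neg_of_superadditive hneg hadd S hS fun θ ↦ by
          have h4 := hSmap fun α ↦ (rootSystem H).pairingIn ℤ α θ
          have h5 := congrFun h1 θ
          rw [Finset.sum_apply] at h5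
          simp only [Pi.smul_apply, smul_eq_mul, g, Pi.zero_apply] at h5
          rw [h5, mul_zero] at h4
          exact_mod_cast h4
        have h4 := hSmap k
        rw [h2, mul_zero] at h4
        have h5 : (S.map k).sum = 0 := by exact_mod_cast h4
        omega)
    exact ⟨f, fun α ↦ by simpa using hf (e α)⟩
  set r := f (0, 1) with hr
  have hsplit : ∀ α, f (g α, -(k α : ℚ)) = f (g α, 0) - k α * r := by
    intro α
    have : ((g α, -(k α : ℚ)) : (H.root → ℚ) × ℚ) = (g α, 0) + (-(k α : ℚ)) • (0, 1) := by
      simp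
    rw [this, map_add, map_smul, smul_eq_mul]
    ring
  have hgneg : ∀ α, f (g (negRoot α), 0) = -f (g α, 0) := by
    intro α
    rw [← map_neg]
    congr 1
    ext θ
    · simp [g, pairingIn_negRoot]
    · simp
  have hupper : ∀ α, f (g α, 0) < (k α + 1) * r := by
    intro α
    have h1 := hf (negRoot α)
    rw [hsplit, hgneg, hneg] at h1
    push_cast at h1
    linarith
  have hlower : ∀ α, k α * r < f (g α, 0) := by
    intro α
    have h1 := hf α
    rw [hsplit] at h1
    linarith
  -- The inequalities for `α` and `-α` give `k r < f < (k + 1) r`, which forces `r > 0`; division by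
  -- `r` then yields the point.
  have hrpos : 0 < r := by
    have h1 := hupper (highestRoot b)
    have h2 := hlower (highestRoot b)
    linarith
  obtain ⟨x, hx⟩ := exists_rootForm_simple_eq b fun i ↦ ((f (g i.1, 0) / r : ℚ) : ℝ)
  have hxα : ∀ α, rootForm H α x = ((f (g α, 0) / r : ℚ) : ℝ) := by
    intro α
    obtain ⟨n, -, -, hn⟩ := b.exists_root_eq_sum_int α
    have hgα : ((g α, 0) : (H.root → ℚ) × ℚ)
        = ∑ i ∈ b.support, (n i : ℚ) • ((g i, 0) : (H.root → ℚ) × ℚ) := by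
      refine Prod.ext ?_ ?_
      · rw [Prod.fst_sum]
        funext θ
        rw [Finset.sum_apply]
        have h1 := rootForm_eq_sum _ _ (fun i ↦ i) hn (corootElt H θ)
        simp only [rootForm_corootElt_eq] at h1
        simp only [Prod.smul_fst, Pi.smul_apply, smul_eq_mul, g]
        exact_mod_cast h1
      · rw [Prod.snd_sum]
        simp
    rw [rootForm_eq_sum _ _ (fun i ↦ i) hn, hgα, map_sum, Finset.sum_div, Rat.cast_sum]
    refine Finset.sum_congr rfl fun i hi ↦ ?_
    rw [hx ⟨i, hi⟩, map_smul, smul_eq_mul, mul_div_assoc, Rat.cast_mul, Rat.cast_intCast]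
  refine ⟨x, fun α ↦ ?_⟩
  rw [hxα]
  have h1 : (k α : ℚ) < f (g α, 0) / r := by
    rw [lt_div_iff₀ hrpos]
    exact hlower α
  have h2 : f (g α, 0) / r < k α + 1 := by
    rw [div_lt_iff₀ hrpos]
    exact hupper α
  constructor
  · exact_mod_cast h1
  · exact_mod_cast h2

end

section

/-! ### Brackets of root spaces -/

open LieModule in
/-- If the sum of two roots is a root, then the root spaces do not commute. -/
theorem exists_lie_ne_zero {α β γ : H.root}
    (h : (rootSystem H).root γ = (rootSystem H).root α + (rootSystem H).root β) :
    ∃ x ∈ rootSpace H α.1, ∃ y ∈ rootSpace H β.1, ⁅x, y⁆ ≠ 0 := by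
  -- The `sl₂`-triple is taken for `-α`, so that its lowering operator `f` lies in the root space of
  -- `α`. Starting at the top of the chain through `β`, `n` applications of `f` reach the root space
  -- of `β`.
  have hα : (-α.1).IsNonZero := (H.isNonZero_coe_root α).neg
  have hfun : (γ.1 : H → ℂ) = (-(1 : ℤ)) • ((-α.1 : Weight ℂ H 𝔤) : H → ℂ) + β.1 := by
    funext z
    have := LinearMap.congr_fun h z
    simpa using this
  obtain ⟨x, hx, hx0⟩ := (chainTop (-α.1 : Weight ℂ H 𝔤) β.1).exists_ne_zero
  obtain ⟨h', e, f, isSl2, he, hf⟩ := exists_isSl2Triple_of_weight_isNonZero hα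
  obtain rfl := isSl2.h_eq_coroot hα he hf
  have prim : isSl2.HasPrimitiveVectorWith x (chainLength (-α.1) β.1 : ℂ) :=
    have := lie_mem_genWeightSpace_of_mem_genWeightSpace he hx
    ⟨hx0, (chainLength_smul _ _ hx).symm, by rwa [genWeightSpace_add_chainTop _ _ hα] at this⟩
  have hbot : (1 : ℤ) ≤ chainBotCoeff (-α.1 : Weight ℂ H 𝔤) β.1 := by
    refine le_chainBotCoeff_of_rootSpace_ne_top _ _ hα 1 ?_
    rw [← hfun]
    exact γ.1.genWeightSpace_ne_bot
  have hlen := chainBotCoeff_add_chainTopCoeff (-α.1 : Weight ℂ H 𝔤) β.1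
  set n := chainTopCoeff (-α.1 : Weight ℂ H 𝔤) β.1 with hn
  refine ⟨f, ?_, ((toEnd ℂ 𝔤 𝔤 f ^ n : Module.End ℂ 𝔤) x), ?_, ?_⟩
  · have h1 : -((-α.1 : Weight ℂ H 𝔤) : H → ℂ) = α.1 := by
      rw [Weight.coe_neg, neg_neg]
    rwa [h1] at hf
  · have h1 := toEnd_pow_apply_mem hf hx n
    have h2 : n • -((-α.1 : Weight ℂ H 𝔤) : H → ℂ) + chainTop (-α.1 : Weight ℂ H 𝔤) β.1
        = β.1 := by
      rw [coe_chainTop', ← hn, smul_neg, neg_add_cancel_left]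
    rwa [h2] at h1
  -- As `α + β` is a root, the chain continues at least one step below `β`, so `n + 1` is at most
  -- its length.
  · have h1 := prim.pow_toEnd_f_ne_zero_of_eq_nat rfl (i := n + 1) (by omega)
    rwa [pow_succ', Module.End.mul_apply, toEnd_apply_apply] at h1

theorem lie_eq_zero_or_mem_rootSpace {α β : H.root}
    (hne : (rootSystem H).root α ≠ -(rootSystem H).root β) {x y : 𝔤}
    (hx : x ∈ rootSpace H α.1) (hy : y ∈ rootSpace H β.1) :
    ⁅x, y⁆ = 0 ∨ ∃ γ : H.root,
      (rootSystem H).root γ = (rootSystem H).root α + (rootSystem H).root β ∧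
        ⁅x, y⁆ ∈ rootSpace H γ.1 := by
  have h := LieAlgebra.lie_mem_genWeightSpace_of_mem_genWeightSpace hx hy
  by_cases hbot : rootSpace H ((α.1 : H → ℂ) + β.1) = ⊥
  · left
    change _ ∈ rootSpace H _ at h
    rw [hbot] at h
    simpa using h
  right
  let γ : LieModule.Weight ℂ H 𝔤 := ⟨(α.1 : H → ℂ) + β.1, hbot⟩
  have hγ : γ.IsNonZero := by
    intro h0
    refine hne (LinearMap.ext fun z ↦ ?_)
    have h1 : (α.1 : H → ℂ) + β.1 = 0 := h0
    have h2 := congrFun h1 z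
    simp only [Pi.add_apply, Pi.zero_apply] at h2
    simpa using eq_neg_of_add_eq_zero_left h2
  exact ⟨⟨γ, by simpa [LieSubalgebra.root] using hγ⟩, rfl, h⟩

theorem root_ne_neg_of_isPos {b : (rootSystem H).Base} {α β : H.root} (hα : b.IsPos α)
    (hβ : b.IsPos β) : (rootSystem H).root α ≠ -(rootSystem H).root β := by
  intro h
  rw [← root_negRoot] at h
  rw [(rootSystem H).root.injective h, isPos_negRoot] at hα
  exact hα hβ

theorem rootSpace_le_of_mem {φ : H.root} {V : Submodule ℂ 𝔤} {x : 𝔤}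
    (hx : x ∈ rootSpace H φ.1) (hxV : x ∈ V) (hx0 : x ≠ 0) :
    (rootSpace H φ.1).toSubmodule ≤ V := by
  have hatom := Submodule.isAtom_iff_finrank_eq_one.mpr
    (finrank_rootSpace_eq_one φ.1 (H.isNonZero_coe_root φ))
  by_contra hle
  have := (hatom.not_le_iff_disjoint.mp hle)
  exact hx0 (Submodule.disjoint_def.mp this x hx hxV)

theorem disjoint_rootSpace_iSup (φ : H.root) (S : Set (H → ℂ)) (hφ : (φ.1 : H → ℂ) ∉ S) :
    Disjoint (rootSpace H φ.1).toSubmodule (⨆ χ ∈ S, (rootSpace H χ).toSubmodule) := by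
  have h1 := LieModule.iSupIndep_genWeightSpace ℂ H 𝔤
  rw [← LieSubmodule.iSupIndep_toSubmodule] at h1
  exact (h1 (φ.1 : H → ℂ)).mono_right
    (iSup₂_le fun χ hχ ↦ le_iSup₂_of_le χ (by rintro rfl; exact hφ hχ) le_rfl)

/-! ### Abelian ideals of the Borel subalgebra and their roots -/

variable {b : (rootSystem H).Base}

theorem cartan_le_borel {x : 𝔤} (hx : x ∈ H) : x ∈ borel b :=
  Submodule.mem_sup_left hx

theorem rootSpace_le_borel {φ : H.root} (hφ : b.IsPos φ) {x : 𝔤} (hx : x ∈ rootSpace H φ.1) :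
    x ∈ borel b :=
  Submodule.mem_sup_right (Submodule.mem_iSup_of_mem φ (Submodule.mem_iSup_of_mem hφ hx))

theorem isPos_of_rootSpace_le_borel {φ : H.root}
    (h : (rootSpace H φ.1).toSubmodule ≤ (borel b).toSubmodule) : b.IsPos φ := by
  by_contra hφ
  -- The weight `0` is included to account for the Cartan part of the Borel subalgebra.
  let S : Set (H → ℂ) := insert 0 {χ | ∃ α : H.root, b.IsPos α ∧ χ = α.1}
  have hdisj := disjoint_rootSpace_iSup φ S (by
    rintro (h0 | ⟨α, hα, h1⟩)
    · exact H.isNonZero_coe_root φ h0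
    · have : φ = α := by
        apply (rootSystem H).root.injective
        exact LinearMap.ext fun z ↦ congrFun h1 z
      exact hφ (this ▸ hα))
  have hle : (borel b).toSubmodule ≤ ⨆ χ ∈ S, (rootSpace H χ).toSubmodule := by
    refine sup_le ?_ (iSup₂_le fun α hα ↦ le_iSup₂_of_le (α.1 : H → ℂ)
      (Set.mem_insert_of_mem _ ⟨α, hα, rfl⟩) le_rfl)
    refine le_iSup₂_of_le (0 : H → ℂ) (Set.mem_insert _ _) ?_
    intro x hx
    exact toLieSubmodule_le_rootSpace_zero ℂ 𝔤 H hx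
  obtain ⟨x, hx, hx0⟩ := φ.1.exists_ne_zero
  exact hx0 (Submodule.disjoint_def.mp hdisj x hx (hle (h hx)))

theorem mem_toSubspace {ξ : AbelianIdeal b} {v : 𝔤} :
    v ∈ ξ.toSubspace ↔ ∃ h : v ∈ borel b, (⟨v, h⟩ : borel b) ∈ ξ.1 := by
  constructor
  · rintro ⟨y, hy, rfl⟩
    exact ⟨y.2, hy⟩
  · rintro ⟨h, hv⟩
    exact ⟨⟨v, h⟩, hv, rfl⟩

theorem toSubspace_le (ξ : AbelianIdeal b) : ξ.toSubspace ≤ (borel b).toSubmodule :=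
  fun _ hv ↦ (mem_toSubspace.mp hv).1

theorem lie_mem_toSubspace {ξ : AbelianIdeal b} {x v : 𝔤} (hx : x ∈ borel b)
    (hv : v ∈ ξ.toSubspace) : ⁅x, v⁆ ∈ ξ.toSubspace := by
  obtain ⟨h, hv⟩ := mem_toSubspace.mp hv
  exact mem_toSubspace.mpr ⟨(borel b).lie_mem hx h, ξ.1.lie_mem (x := (⟨x, hx⟩ : borel b)) hv⟩

theorem lie_eq_zero_of_mem_toSubspace {ξ : AbelianIdeal b} {v w : 𝔤} (hv : v ∈ ξ.toSubspace)
    (hw : w ∈ ξ.toSubspace) : ⁅v, w⁆ = 0 := by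
  obtain ⟨h, hv⟩ := mem_toSubspace.mp hv
  obtain ⟨h', hw⟩ := mem_toSubspace.mp hw
  have := ξ.2
  have h1 := LieModule.IsTrivial.trivial (⟨⟨v, h⟩, hv⟩ : ξ.1) (⟨⟨w, h'⟩, hw⟩ : ξ.1)
  have h2 := congrArg (fun z : ξ.1 ↦ ((z : borel b) : 𝔤)) h1
  exact h2

theorem toSubspace_injective : Function.Injective (AbelianIdeal.toSubspace b) := by
  intro ξ η h
  apply Subtype.ext
  ext y
  have h1 : (y : 𝔤) ∈ ξ.toSubspace ↔ (y : 𝔤) ∈ η.toSubspace := by rw [h]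
  rw [mem_toSubspace, mem_toSubspace] at h1
  constructor
  · intro hy
    exact (h1.mp ⟨y.2, hy⟩).2
  · intro hy
    exact (h1.mpr ⟨y.2, hy⟩).2

theorem exists_toSubspace_eq {V : Submodule ℂ 𝔤} (hV : V ≤ (borel b).toSubmodule)
    (hlie : ∀ x ∈ borel b, ∀ v ∈ V, ⁅x, v⁆ ∈ V) (habel : ∀ v ∈ V, ∀ w ∈ V, ⁅v, w⁆ = 0) :
    ∃ ξ : AbelianIdeal b, ξ.toSubspace = V := by
  let I : LieIdeal ℂ (borel b) :=
    { V.comap (borel b).toSubmodule.subtype with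
      lie_mem := fun {x m} hm ↦ hlie x.1 x.2 m.1 hm }
  have hI : IsLieAbelian I :=
    ⟨fun v w ↦ Subtype.ext (Subtype.ext (habel v.1.1 v.2 w.1.1 w.2))⟩
  refine ⟨⟨I, hI⟩, ?_⟩
  ext v
  rw [mem_toSubspace]
  constructor
  · rintro ⟨h, hv⟩
    exact hv
  · intro hv
    exact ⟨hV hv, hv⟩

variable (b) in
/-- The sets of positive roots which are closed under adding positive roots and in which no two
elements add up to a root. -/
structure IsAbelianRootSet (I : Set H.root) : Prop where
  isPos : ∀ φ ∈ I, b.IsPos φ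
  add_mem : ∀ φ ∈ I, ∀ α, b.IsPos α → ∀ θ,
    (rootSystem H).root θ = (rootSystem H).root α + (rootSystem H).root φ → θ ∈ I
  add_ne : ∀ φ ∈ I, ∀ α ∈ I, ∀ θ,
    (rootSystem H).root θ ≠ (rootSystem H).root α + (rootSystem H).root φ

/-- Root spaces are lines and their bracket is nonzero when the sum is a root, so statements on
brackets become statements on sums of roots. -/
theorem isAbelianRootSet_rootsOf (ξ : AbelianIdeal b) :
    IsAbelianRootSet b (rootsOf H ξ.toSubspace) where
  isPos φ hφ := isPos_of_rootSpace_le_borel (le_trans hφ (toSubspace_le ξ))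
  add_mem := by
    intro φ hφ α hα θ hθ
    have hφpos := isPos_of_rootSpace_le_borel (le_trans hφ (toSubspace_le ξ))
    obtain ⟨x, hx, y, hy, h0⟩ := exists_lie_ne_zero hθ
    have hmem := lie_mem_toSubspace (ξ := ξ) (rootSpace_le_borel hα hx) (hφ hy)
    rcases lie_eq_zero_or_mem_rootSpace (root_ne_neg_of_isPos hα hφpos) hx hy with h | ⟨γ, hγ, h⟩
    · exact absurd h h0
    · have : γ = θ := (rootSystem H).root.injective (hγ.trans hθ.symm)
      subst this
      exact rootSpace_le_of_mem h hmem h0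
  add_ne := by
    intro φ hφ α hα θ hθ
    obtain ⟨x, hx, y, hy, h0⟩ := exists_lie_ne_zero hθ
    exact h0 (lie_eq_zero_of_mem_toSubspace (hα hx) (hφ hy))

/-- For `e` in a positive root space, `[x, e] = φ(x) e` lies in the ideal, so commutativity gives
`φ(x)² e = [x, [x, e]] = 0`. All roots then vanish at `x`. -/
theorem eq_zero_of_mem_toSubspace_of_mem_cartan {ξ : AbelianIdeal b} {x : 𝔤}
    (hx : x ∈ ξ.toSubspace) (hxH : x ∈ H) : x = 0 := by
  have hpos : ∀ φ : H.root, b.IsPos φ → φ.1 (⟨x, hxH⟩ : H) = 0 := by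
    intro φ hφ
    obtain ⟨e, he, he0⟩ := φ.1.exists_ne_zero
    have h1 : ⁅x, e⁆ = φ.1 (⟨x, hxH⟩ : H) • e :=
      lie_eq_smul_of_mem_rootSpace he ⟨x, hxH⟩
    have h2 : ⁅x, e⁆ ∈ ξ.toSubspace := by
      rw [← lie_skew]
      exact neg_mem (lie_mem_toSubspace (rootSpace_le_borel hφ he) hx)
    have h3 := lie_eq_zero_of_mem_toSubspace hx h2
    rw [h1, lie_smul, h1, smul_smul] at h3
    simpa [he0] using h3
  have hmem : (⟨x, hxH⟩ : H) ∈ ⨅ α : LieModule.Weight ℂ H 𝔤, α.ker := by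
    refine (Submodule.mem_iInf _).mpr fun μ ↦ ?_
    by_cases hμ : μ.IsNonZero
    · let φ : H.root := ⟨μ, by simpa [LieSubalgebra.root] using hμ⟩
      rcases isPos_or_isPos_negRoot b φ with h | h
      · exact hpos φ h
      · have h1 : (rootSystem H).root (negRoot φ) ⟨x, hxH⟩ = 0 := hpos _ h
        rw [root_negRoot, LinearMap.neg_apply, neg_eq_zero] at h1
        exact h1
    · simp only [LieModule.Weight.IsNonZero, not_not] at hμ
      exact LinearMap.mem_ker.mpr (congr_fun hμ _)
  rw [iInf_ker_weight_eq_bot, Submodule.mem_bot] at hmem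
  exact congrArg Subtype.val hmem

/-- Stability under the Cartan subalgebra splits the ideal into weight components; the component of
weight zero vanishes. -/
theorem toSubspace_eq_iSup (ξ : AbelianIdeal b) :
    ξ.toSubspace = ⨆ φ ∈ rootsOf H ξ.toSubspace, (rootSpace H φ.1).toSubmodule := by
  refine le_antisymm ?_ (iSup₂_le fun φ hφ ↦ hφ)
  let N : LieSubmodule ℂ H 𝔤 :=
    { ξ.toSubspace with
      lie_mem := fun {x m} hm ↦ lie_mem_toSubspace (cartan_le_borel x.2) hm }
  have h1 := congrArg LieSubmodule.toSubmodule (LieModule.eq_iSup_inf_genWeightSpace ℂ H 𝔤 N)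
  rw [LieSubmodule.iSup_toSubmodule] at h1
  change ξ.toSubspace = _ at h1
  conv_lhs => rw [h1]
  refine iSup_le fun χ ↦ ?_
  rintro x ⟨hxN, hxχ⟩
  by_cases hx0 : x = 0
  · rw [hx0]
    exact zero_mem _
  by_cases hχ : χ.IsNonZero
  · let φ : H.root := ⟨χ, by simpa [LieSubalgebra.root] using hχ⟩
    have h2 : φ ∈ rootsOf H ξ.toSubspace := rootSpace_le_of_mem (φ := φ) hxχ hxN hx0
    exact Submodule.mem_iSup_of_mem φ (Submodule.mem_iSup_of_mem h2 hxχ)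
  · simp only [LieModule.Weight.IsNonZero, not_not] at hχ
    refine absurd (eq_zero_of_mem_toSubspace_of_mem_cartan hxN ?_) hx0
    have h2 : x ∈ rootSpace H (χ : H → ℂ) := hxχ
    rw [hχ.eq, rootSpace_zero_eq] at h2
    exact h2

theorem rootsOf_injective :
    Function.Injective fun ξ : AbelianIdeal b ↦ rootsOf H ξ.toSubspace := by
  intro ξ η h
  apply toSubspace_injective
  rw [toSubspace_eq_iSup ξ, toSubspace_eq_iSup η]
  simp only at h
  rw [h]

theorem exists_rootsOf_eq {I : Set H.root} (hI : IsAbelianRootSet b I) :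
    ∃ ξ : AbelianIdeal b, rootsOf H ξ.toSubspace = I := by
  set V : Submodule ℂ 𝔤 := ⨆ φ ∈ I, (rootSpace H φ.1).toSubmodule with hV
  have hmem : ∀ φ ∈ I, ∀ x ∈ rootSpace H φ.1, x ∈ V := fun φ hφ x hx ↦
    Submodule.mem_iSup_of_mem φ (Submodule.mem_iSup_of_mem hφ hx)
  have hVspan : V = Submodule.span ℂ {x | ∃ φ ∈ I, x ∈ rootSpace H φ.1} := by
    refine le_antisymm (iSup₂_le fun φ hφ x hx ↦ Submodule.subset_span ⟨φ, hφ, hx⟩) ?_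
    rw [Submodule.span_le]
    rintro x ⟨φ, hφ, hx⟩
    exact hmem φ hφ x hx
  obtain ⟨ξ, hξ⟩ := exists_toSubspace_eq (b := b) (V := V)
    (iSup₂_le fun φ hφ x hx ↦ rootSpace_le_borel (hI.isPos φ hφ) hx) (by
      intro x hx v hv
      rw [hVspan] at hv
      induction hv using Submodule.span_induction with
      | mem v hv =>
        obtain ⟨φ, hφ, hv⟩ := hv
        have hle : (borel b).toSubmodule ≤ V.comap (LieAlgebra.ad ℂ 𝔤 v) := by
          refine sup_le (fun x hx ↦ ?_) (iSup₂_le fun α hα x hx ↦ ?_)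
          · change ⁅v, x⁆ ∈ V
            rw [← lie_skew]
            exact neg_mem (hmem φ hφ _ ((rootSpace H φ.1).lie_mem (x := ⟨x, hx⟩) hv))
          · change ⁅v, x⁆ ∈ V
            rw [← lie_skew]
            refine neg_mem ?_
            rcases lie_eq_zero_or_mem_rootSpace
              (root_ne_neg_of_isPos hα (hI.isPos φ hφ)) hx hv with h | ⟨γ, hγ, h⟩
            · rw [h]
              exact zero_mem _
            · exact hmem γ (hI.add_mem φ hφ α hα γ hγ) _ h
        rw [← lie_skew]
        exact neg_mem (hle hx)
      | zero => rw [lie_zero]; exact zero_mem _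
      | add v w _ _ h1 h2 => rw [lie_add]; exact add_mem h1 h2
      | smul a v _ h1 => rw [lie_smul]; exact Submodule.smul_mem _ _ h1) (by
      intro v hv w hw
      rw [hVspan] at hv hw
      induction hv using Submodule.span_induction with
      | mem v hv =>
        induction hw using Submodule.span_induction with
        | mem w hw =>
          obtain ⟨φ, hφ, hv⟩ := hv
          obtain ⟨α, hα, hw⟩ := hw
          rcases lie_eq_zero_or_mem_rootSpace
            (root_ne_neg_of_isPos (hI.isPos φ hφ) (hI.isPos α hα)) hv hw with h | ⟨γ, hγ, -⟩
          · exact h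
          · exact absurd hγ (hI.add_ne α hα φ hφ γ)
        | zero => rw [lie_zero]
        | add w u _ _ h1 h2 => rw [lie_add, h1, h2, add_zero]
        | smul a w _ h1 => rw [lie_smul, h1, smul_zero]
      | zero => rw [zero_lie]
      | add v u _ _ h1 h2 => rw [add_lie, h1, h2, add_zero]
      | smul a v _ h1 => rw [smul_lie, h1, smul_zero])
  refine ⟨ξ, ?_⟩
  rw [hξ]
  ext φ
  constructor
  · intro hφ
    by_contra hφI
    obtain ⟨x, hx, hx0⟩ := φ.1.exists_ne_zero
    have hdisj := disjoint_rootSpace_iSup φ {χ | ∃ α ∈ I, χ = (α.1 : H → ℂ)} (by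
      rintro ⟨α, hα, h1⟩
      have : φ = α := by
        apply (rootSystem H).root.injective
        exact LinearMap.ext fun z ↦ congrFun h1 z
      exact hφI (this ▸ hα))
    have hle : V ≤ ⨆ χ ∈ {χ | ∃ α ∈ I, χ = (α.1 : H → ℂ)}, (rootSpace H χ).toSubmodule :=
      iSup₂_le fun α hα ↦ le_iSup₂_of_le (α.1 : H → ℂ) ⟨α, hα, rfl⟩ le_rfl
    exact hx0 (Submodule.disjoint_def.mp hdisj x hx (hle (hφ hx)))
  · exact fun hφ x hx ↦ hmem φ hφ x hx

end

section

/-! ### The position of an alcove -/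

variable {b : (rootSystem H).Base}

theorem rootForm_mem_Icc_of_mem_fundamentalAlcove {u : realCartan H}
    (hu : u ∈ fundamentalAlcove b) {φ : H.root} (hφ : b.IsPos φ) :
    0 ≤ rootForm H φ u ∧ rootForm H φ u ≤ 1 :=
  ⟨rootForm_nonneg_of_simple hu.1 hφ, (rootForm_le_highestRoot hu.1 φ).trans hu.2⟩

variable (b) in
/-- The integral part of a root on the alcove of an element of the affine Weyl group. -/
def alcoveFloor (σ : affineWeylGroup H) (φ : H.root) : ℤ := ⌊rootForm H φ (σ.1 (twoRho b))⌋

/-- On `A₁` positive roots take values in `[0, 1]` and negative ones in `[-1, 0]`, while `σ`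
permutes roots up to integers. So `A_σ` lies in one unit slab for each root, and the point `σ(2ρ)`
tells which. -/
theorem alcoveFloor_le (σ : affineWeylGroup H) (φ : H.root) {u : realCartan H}
    (hu : u ∈ fundamentalAlcove b) :
    (alcoveFloor b σ φ : ℝ) ≤ rootForm H φ (σ.1 u) ∧
      rootForm H φ (σ.1 u) ≤ alcoveFloor b σ φ + 1 := by
  obtain ⟨π, n, h⟩ := exists_perm_of_mem_affineWeylGroup σ.2
  have hz : twoRho b ∈ openAlcove b := twoRho_mem_openAlcove
  rw [alcoveFloor, h, h, Int.floor_intCast_add]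
  rcases isPos_or_isPos_negRoot b (π φ) with hpos | hneg
  · have h1 := hz _ hpos
    have h2 := rootForm_mem_Icc_of_mem_fundamentalAlcove hu hpos
    have h3 : ⌊rootForm H (π φ) (twoRho b)⌋ = 0 := by
      rw [Int.floor_eq_zero_iff]
      exact ⟨h1.1.le, h1.2⟩
    rw [h3]
    push_cast
    constructor <;> linarith
  · have h1 := hz _ hneg
    have h2 := rootForm_mem_Icc_of_mem_fundamentalAlcove hu hneg
    rw [rootForm_negRoot] at h1 h2
    have h3 : ⌊rootForm H (π φ) (twoRho b)⌋ = -1 := by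
      rw [Int.floor_eq_iff]
      push_cast
      constructor <;> linarith
    rw [h3]
    push_cast
    constructor <;> linarith

theorem floor_rootForm_eq_alcoveFloor (σ : affineWeylGroup H) (φ : H.root) {y : realCartan H}
    (hy : y ∈ openAlcove b) : ⌊rootForm H φ (σ.1 y)⌋ = alcoveFloor b σ φ := by
  have h1 := alcoveFloor_le σ φ (mem_fundamentalAlcove_of_mem_openAlcove hy)
  rw [Int.floor_eq_iff]
  refine ⟨h1.1, lt_of_le_of_ne h1.2 fun h2 ↦ ?_⟩
  refine rootForm_affine_ne_int σ.2 hy φ (alcoveFloor b σ φ + 1) ?_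
  rw [h2]
  push_cast
  rfl

theorem twoRho_mem_fundamentalAlcove : twoRho b ∈ fundamentalAlcove b :=
  mem_fundamentalAlcove_of_mem_openAlcove twoRho_mem_openAlcove

theorem mem_dominantElements_iff {σ : affineWeylGroup H} :
    σ ∈ dominantElements b ↔ ∀ φ, b.IsPos φ → 0 ≤ alcoveFloor b σ φ := by
  constructor
  · intro h φ hφ
    exact Int.floor_nonneg.mpr (h ⟨_, twoRho_mem_fundamentalAlcove, rfl⟩ φ hφ)
  · rintro h _ ⟨u, hu, rfl⟩ φ hφ
    have h1 : (0 : ℝ) ≤ alcoveFloor b σ φ := by exact_mod_cast h φ hφ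
    exact h1.trans (alcoveFloor_le σ φ hu).1

theorem mem_truncatedElements_iff {σ : affineWeylGroup H} :
    σ ∈ truncatedElements b 2 ↔
      ∀ φ, b.IsPos φ → 0 ≤ alcoveFloor b σ φ ∧ alcoveFloor b σ φ ≤ 1 := by
  constructor
  · rintro ⟨h1, h2⟩ φ hφ
    refine ⟨mem_dominantElements_iff.mp h1 φ hφ, ?_⟩
    obtain ⟨h3, h4⟩ := h2 ⟨twoRho b, twoRho_mem_fundamentalAlcove, rfl⟩
    have h5 := rootForm_le_highestRoot (fun i hi ↦ h3 i (b.isPos_of_mem_support hi)) φ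
    -- Strictness off the walls turns the closed bound `2` into floor at most `1`.
    have h6 := floor_lt_rootForm_affine σ.2 (twoRho_mem_openAlcove (b := b)) φ
    have h7 : (alcoveFloor b σ φ : ℝ) < (2 : ℕ) := h6.trans_le (h5.trans h4)
    have h8 : alcoveFloor b σ φ < 2 := by exact_mod_cast h7
    omega
  · intro h
    have h1 : σ ∈ dominantElements b := mem_dominantElements_iff.mpr fun φ hφ ↦ (h φ hφ).1
    refine ⟨h1, ?_⟩
    rintro _ ⟨u, hu, rfl⟩
    refine ⟨h1 ⟨u, hu, rfl⟩, ?_⟩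
    have h2 := (alcoveFloor_le σ (highestRoot b) hu).2
    have h3 : (alcoveFloor b σ (highestRoot b) : ℝ) ≤ 1 := by
      exact_mod_cast (h _ (isPos_highestRoot b)).2
    push_cast
    linarith

theorem mem_truncatedElements_iff_half {σ : affineWeylGroup H} :
    σ ∈ truncatedElements b 2 ↔ (1 / 2 : ℝ) • σ.1 (twoRho b) ∈ openAlcove b := by
  rw [mem_truncatedElements_iff]
  refine forall₂_congr fun φ hφ ↦ ?_
  rw [map_smul, smul_eq_mul]
  have h1 := floor_lt_rootForm_affine σ.2 (twoRho_mem_openAlcove (b := b)) φ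
  have h2 := Int.lt_floor_add_one (rootForm H φ (σ.1 (twoRho b)))
  change (alcoveFloor b σ φ : ℝ) < _ at h1
  change _ < (alcoveFloor b σ φ : ℝ) + 1 at h2
  constructor
  · rintro ⟨h3, h4⟩
    have h5 : (0 : ℝ) ≤ alcoveFloor b σ φ := by exact_mod_cast h3
    have h6 : (alcoveFloor b σ φ : ℝ) ≤ 1 := by exact_mod_cast h4
    constructor <;> linarith
  · rintro ⟨h3, h4⟩
    have h5 : (-1 : ℝ) < alcoveFloor b σ φ := by linarith
    have h6 : (alcoveFloor b σ φ : ℝ) < 2 := by linarith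
    have h7 : -1 < alcoveFloor b σ φ := by exact_mod_cast h5
    have h8 : alcoveFloor b σ φ < 2 := by exact_mod_cast h6
    omega

/-- The floor is superadditive with values `0` and `1` on positive roots: `1 + 0` forces `1` on the
sum, and `1 + 1` leaves no room for the sum to be a root. -/
theorem isAbelianRootSet_of_mem_truncatedElements {σ : affineWeylGroup H}
    (hσ : σ ∈ truncatedElements b 2) :
    IsAbelianRootSet b {φ | b.IsPos φ ∧ alcoveFloor b σ φ = 1} := by
  rw [mem_truncatedElements_iff] at hσ
  have hadd : ∀ θ α φ, (rootSystem H).root θ = (rootSystem H).root α + (rootSystem H).root φ →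
      alcoveFloor b σ α + alcoveFloor b σ φ ≤ alcoveFloor b σ θ := by
    intro θ α φ h
    rw [alcoveFloor, alcoveFloor, alcoveFloor, rootForm_add h]
    exact Int.le_floor_add _ _
  refine ⟨fun φ hφ ↦ hφ.1, ?_, ?_⟩
  · rintro φ ⟨hφ, h1⟩ α hα θ hθ
    have h2 := hα.add hφ hθ
    have h3 := hadd θ α φ hθ
    have h4 := hσ θ h2
    have h5 := hσ α hα
    exact ⟨h2, by omega⟩
  · rintro φ ⟨hφ, h1⟩ α ⟨hα, h2⟩ θ hθ
    have h3 := hadd θ α φ hθ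
    have h4 := hσ θ (hα.add hφ hθ)
    omega

open Classical in
/-- Every abelian set of positive roots is cut out by an alcove. -/
theorem exists_alcoveFloor_eq {I : Set H.root} (hI : IsAbelianRootSet b I) :
    ∃ σ : affineWeylGroup H, ∀ φ, b.IsPos φ → alcoveFloor b σ φ = if φ ∈ I then 1 else 0 := by
  let ind : H.root → ℤ := fun φ ↦ if φ ∈ I then 1 else 0
  have hind : ∀ φ, 0 ≤ ind φ ∧ ind φ ≤ 1 := fun φ ↦ by
    simp only [ind]
    split_ifs <;> omega
  have hsup : ∀ θ α β, b.IsPos α → b.IsPos β →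
      (rootSystem H).root θ = (rootSystem H).root α + (rootSystem H).root β →
      ind α + ind β ≤ ind θ := by
    intro θ α β hα hβ h
    have h' := h
    rw [add_comm] at h'
    by_cases h1 : α ∈ I
    · have h2 : β ∉ I := fun h2 ↦ hI.add_ne β h2 α h1 θ h
      have h3 : θ ∈ I := hI.add_mem α h1 β hβ θ h'
      simp [ind, h1, h2, h3]
    · by_cases h2 : β ∈ I
      · have h3 : θ ∈ I := hI.add_mem β h2 α hα θ h
        simp [ind, h1, h2, h3]
      · have := hind θ
        simp only [ind, h1, h2, if_false] at this ⊢
        omega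
  -- The value on negative roots is dictated by `⌊-t⌋ = -⌊t⌋ - 1`.
  let k : H.root → ℤ := fun φ ↦ if b.IsPos φ then ind φ else -ind (negRoot φ) - 1
  have hkpos : ∀ φ, b.IsPos φ → k φ = ind φ := fun φ hφ ↦ if_pos hφ
  have hkneg : ∀ φ, b.IsPos (negRoot φ) → k φ = -ind (negRoot φ) - 1 := fun φ hφ ↦
    if_neg ((isPos_negRoot b φ).mp hφ)
  have hneg : ∀ α, k (negRoot α) = -k α - 1 := by
    intro α
    rcases isPos_or_isPos_negRoot b α with h | h
    · rw [hkneg (negRoot α) (by rwa [negRoot_negRoot]), negRoot_negRoot, hkpos α h]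
    · rw [hkneg α h, hkpos _ h]
      ring
  have hadd : ∀ φ α β, (rootSystem H).root φ = (rootSystem H).root α + (rootSystem H).root β →
      k α + k β ≤ k φ := by
    intro φ α β h
    rcases isPos_or_isPos_negRoot b α with hα | hα <;>
    rcases isPos_or_isPos_negRoot b β with hβ | hβ
    · rw [hkpos α hα, hkpos β hβ, hkpos φ (hα.add hβ h)]
      exact hsup φ α β hα hβ h
    · have h1 := hind α
      have h2 := hind (negRoot β)
      rcases isPos_or_isPos_negRoot b φ with hφ | hφ
      · have h3 := hind φ
        rw [hkpos α hα, hkneg β hβ, hkpos φ hφ]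
        omega
      -- When the sum is negative, moving terms across gives the relation `-β = α + (-φ)` among
      -- positive roots.
      · have h3 := hsup (negRoot β) α (negRoot φ) hα hφ (by
          rw [root_negRoot, root_negRoot, h]
          abel)
        rw [hkpos α hα, hkneg β hβ, hkneg φ hφ]
        omega
    · have h1 := hind β
      have h2 := hind (negRoot α)
      rcases isPos_or_isPos_negRoot b φ with hφ | hφ
      · have h3 := hind φ
        rw [hkpos β hβ, hkneg α hα, hkpos φ hφ]
        omega
      · have h3 := hsup (negRoot α) β (negRoot φ) hβ hφ (by
          rw [root_negRoot, root_negRoot, h]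
          abel)
        rw [hkpos β hβ, hkneg α hα, hkneg φ hφ]
        omega
    · have hφ : b.IsPos (negRoot φ) := hα.add hβ (by
        rw [root_negRoot, root_negRoot, root_negRoot, h]
        abel)
      have h1 := hind (negRoot α)
      have h2 := hind (negRoot β)
      have h3 := hind (negRoot φ)
      have h4 : ind (negRoot φ) ≤ ind (negRoot α) + ind (negRoot β) + 1 := by omega
      rw [hkneg α hα, hkneg β hβ, hkneg φ hφ]
      omega
  obtain ⟨x, hx⟩ := exists_floor_eq b hneg hadd
  have hxfloor : ∀ φ, ⌊rootForm H φ x⌋ = k φ := fun φ ↦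
    Int.floor_eq_iff.mpr ⟨(hx φ).1.le, (hx φ).2⟩
  obtain ⟨τ, hτ, hτx⟩ := exists_affine_mem_openAlcove b (x := x) fun φ n hn ↦ by
    have h1 := hxfloor φ
    have h2 := (hx φ).1
    rw [hn, Int.floor_intCast] at h1
    rw [hn, h1] at h2
    exact lt_irrefl _ h2
  -- The inverse is taken because `τ` carries `x` into the fundamental alcove; any interior point,
  -- such as `τ x`, computes the floors.
  refine ⟨⟨τ, hτ⟩⁻¹, fun φ hφ ↦ ?_⟩
  rw [← floor_rootForm_eq_alcoveFloor _ φ hτx]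
  have h1 : ((⟨τ, hτ⟩⁻¹ : affineWeylGroup H) : realCartan H ≃ᵃ[ℝ] realCartan H) (τ x) = x :=
    τ.symm_apply_apply x
  rw [h1, hxfloor, hkpos φ hφ]

/-! ### Abelian ideals and alcoves -/

theorem exists_alcoveFloor_eq_one_iff (ξ : AbelianIdeal b) :
    ∃ σ : affineWeylGroup H, σ ∈ truncatedElements b 2 ∧
      rootsOf H ξ.toSubspace = {φ | b.IsPos φ ∧ alcoveFloor b σ φ = 1} := by
  classical
  obtain ⟨σ, hσ⟩ := exists_alcoveFloor_eq (isAbelianRootSet_rootsOf ξ)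
  refine ⟨σ, mem_truncatedElements_iff.mpr fun φ hφ ↦ ?_, ?_⟩
  · rw [hσ φ hφ]
    split_ifs <;> omega
  · ext φ
    constructor
    · intro h
      have hφ := (isAbelianRootSet_rootsOf ξ).isPos φ h
      exact ⟨hφ, by rw [hσ φ hφ, if_pos h]⟩
    · rintro ⟨hφ, h⟩
      by_contra hn
      rw [hσ φ hφ, if_neg hn] at h
      omega

theorem idealWeight_eq_alcoveWeight {ξ : AbelianIdeal b} {σ : affineWeylGroup H}
    (hσ : σ ∈ truncatedElements b 2)
    (h : rootsOf H ξ.toSubspace = {φ | b.IsPos φ ∧ alcoveFloor b σ φ = 1}) :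
    idealWeight b ξ = alcoveWeight b σ := by
  classical
  rw [mem_truncatedElements_iff] at hσ
  have h1 : idealWeight b ξ = ∑ φ ∈ Finset.univ.filter (· ∈ rootsOf H ξ.toSubspace),
      rootElt H φ := by
    rw [idealWeight, rootSum]
  rw [h1, alcoveWeight_eq, h, Finset.sum_filter, Finset.sum_filter]
  refine Finset.sum_congr rfl fun φ _ ↦ ?_
  change _ = if b.IsPos φ then (alcoveFloor b σ φ : ℝ) • rootElt H φ else 0
  by_cases hφ : b.IsPos φ
  · have h2 := hσ φ hφ
    rcases (by omega : alcoveFloor b σ φ = 0 ∨ alcoveFloor b σ φ = 1) with h3 | h3 <;>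
      simp [hφ, h3]
  · simp [hφ]

variable (b) in
/-- The element of the affine Weyl group attached to an abelian ideal. -/
def idealElement (ξ : AbelianIdeal b) : affineWeylGroup H :=
  (exists_alcoveFloor_eq_one_iff ξ).choose

theorem idealElement_mem (ξ : AbelianIdeal b) : idealElement b ξ ∈ truncatedElements b 2 :=
  (exists_alcoveFloor_eq_one_iff ξ).choose_spec.1

theorem rootsOf_eq (ξ : AbelianIdeal b) : rootsOf H ξ.toSubspace
    = {φ | b.IsPos φ ∧ alcoveFloor b (idealElement b ξ) φ = 1} :=
  (exists_alcoveFloor_eq_one_iff ξ).choose_spec.2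

theorem idealWeight_eq (ξ : AbelianIdeal b) :
    idealWeight b ξ = alcoveWeight b (idealElement b ξ) :=
  idealWeight_eq_alcoveWeight (idealElement_mem ξ) (rootsOf_eq ξ)

theorem bijOn_idealElement :
    Set.BijOn (idealElement b) Set.univ (truncatedElements b 2) := by
  refine ⟨fun ξ _ ↦ idealElement_mem ξ, fun ξ _ η _ h ↦ ?_, fun σ hσ ↦ ?_⟩
  · apply rootsOf_injective
    simp only
    rw [rootsOf_eq ξ, rootsOf_eq η, h]
  · obtain ⟨ξ, hξ⟩ := exists_rootsOf_eq (isAbelianRootSet_of_mem_truncatedElements hσ)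
    refine ⟨ξ, Set.mem_univ _, alcoveWeight_injective (b := b) ?_⟩
    rw [← idealWeight_eq, idealWeight_eq_alcoveWeight hσ hξ]

/-! ### Counting the alcoves of the doubled fundamental alcove -/

theorem exists_coord {γ : realCartan H} (b : (rootSystem H).Base) (hγ : γ ∈ corootLattice H) :
    ∃ n : b.support → ℤ, γ = ∑ i, (n i : ℝ) • corootElt H i.1 := by
  induction hγ using AddSubgroup.closure_induction with
  | mem x hx =>
    obtain ⟨α, rfl⟩ := hx
    obtain ⟨f, -, -, hf⟩ := b.flip.exists_root_eq_sum_int α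
    refine ⟨fun i ↦ f i.1, Subtype.ext ?_⟩
    rw [Submodule.coe_sum]
    have h1 : (rootSystem H).coroot α = ∑ j ∈ b.support, f j • (rootSystem H).coroot j := hf
    rw [← Finset.sum_coe_sort b.support] at h1
    refine Eq.trans h1 (Finset.sum_congr rfl fun i _ ↦ ?_)
    rw [Int.cast_smul_eq_zsmul]
    rfl
  | zero => exact ⟨0, by simp⟩
  | add x y _ _ hx hy =>
    obtain ⟨m, rfl⟩ := hx
    obtain ⟨n, rfl⟩ := hy
    exact ⟨m + n, by simp [add_smul, Finset.sum_add_distrib]⟩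
  | neg x _ hx =>
    obtain ⟨m, rfl⟩ := hx
    exact ⟨-m, by simp⟩

theorem sum_coord_mem (b : (rootSystem H).Base) (n : b.support → ℤ) :
    ∑ i, (n i : ℝ) • corootElt H i.1 ∈ corootLattice H := by
  refine sum_mem fun i _ ↦ ?_
  rw [Int.cast_smul_eq_zsmul]
  exact zsmul_mem (corootElt_mem _) _

theorem coord_unique {m n : b.support → ℤ}
    (h : ∑ i, (m i : ℝ) • corootElt H i.1 = ∑ i, (n i : ℝ) • corootElt H i.1) : m = n := by
  funext i
  have h1 := Fintype.linearIndependent_iffₛ.mp (linearIndependent_corootElt b) _ _ h i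
  exact_mod_cast h1

theorem apply_zero_mem_corootLattice (σ : affineWeylGroup H) : σ.1 0 ∈ corootLattice H := by
  obtain ⟨γ, hγ, w, hw, h⟩ := σ.2
  rw [h, map_zero, add_zero]
  exact hγ

variable (b) in
/-- The coordinates of `σ⁻¹(0)` modulo two. -/
def parity (σ : affineWeylGroup H) (i : b.support) : ZMod 2 :=
  ((exists_coord b (apply_zero_mem_corootLattice σ⁻¹)).choose i : ZMod 2)

theorem parity_eq {σ : affineWeylGroup H} {n : b.support → ℤ}
    (h : (σ⁻¹).1 0 = ∑ i, (n i : ℝ) • corootElt H i.1) (i : b.support) :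
    parity b σ i = (n i : ZMod 2) := by
  have h1 := (exists_coord b (apply_zero_mem_corootLattice σ⁻¹)).choose_spec
  rw [parity, coord_unique (h1.symm.trans h)]

theorem exists_affine_of_mem (δ : realCartan H) (hδ : δ ∈ corootLattice H)
    {w : realCartan H ≃ₗ[ℝ] realCartan H} (hw : w ∈ weylGroup H) :
    ∃ σ : affineWeylGroup H, ∀ x, σ.1 x = δ + w x :=
  ⟨⟨w.toAffineEquiv.trans (AffineEquiv.constVAdd ℝ (realCartan H) δ),
    δ, hδ, w, hw, fun _ ↦ rfl⟩, fun _ ↦ rfl⟩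

theorem apply_inv_apply (σ : affineWeylGroup H) (x : realCartan H) :
    σ.1 ((σ⁻¹).1 x) = x := σ.1.apply_symm_apply x

theorem inv_apply_apply (σ : affineWeylGroup H) (x : realCartan H) :
    (σ⁻¹).1 (σ.1 x) = x := σ.1.symm_apply_apply x

/-- Equal parities put the translation part of `σ'σ⁻¹` in `2Γ`. Its conjugate by the dilation is
then in the affine Weyl group and joins two points of the open alcove, so it is the identity. -/
theorem parity_injOn : Set.InjOn (parity b) (truncatedElements b 2) := by
  intro σ hσ σ' hσ' hp
  obtain ⟨n, hn⟩ := exists_coord b (apply_zero_mem_corootLattice σ⁻¹)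
  obtain ⟨n', hn'⟩ := exists_coord b (apply_zero_mem_corootLattice σ'⁻¹)
  have hm : ∀ i, ∃ m : ℤ, n i - n' i = 2 * m := by
    intro i
    have h1 := congrFun hp i
    rw [parity_eq hn, parity_eq hn', ← sub_eq_zero, ← Int.cast_sub,
      ZMod.intCast_zmod_eq_zero_iff_dvd] at h1
    exact h1
  choose m hm using hm
  set δ := ∑ i, (m i : ℝ) • corootElt H i.1 with hδ
  have hδmem : δ ∈ corootLattice H := sum_coord_mem b m
  have h0 : (σ⁻¹).1 0 = (σ'⁻¹).1 0 + (2 : ℝ) • δ := by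
    rw [hn, hn', hδ, Finset.smul_sum, ← Finset.sum_add_distrib]
    refine Finset.sum_congr rfl fun i _ ↦ ?_
    have : (n i : ℝ) = n' i + 2 * m i := by
      have := hm i
      have h2 : n i = n' i + 2 * m i := by omega
      exact_mod_cast h2
    rw [this]
    module
  obtain ⟨γ', hγ', w', hw', h'⟩ := σ'.2
  obtain ⟨γ, hγ, w, hw, h⟩ := (σ' * σ⁻¹).2
  have hγδ : γ = (2 : ℝ) • w' δ := by
    have h1 := h 0
    rw [map_zero w, add_zero] at h1
    have h2 : (σ' * σ⁻¹).1 0 = σ'.1 ((σ⁻¹).1 0) := rfl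
    have h3 := apply_inv_apply σ' 0
    rw [h'] at h3
    rw [← h1, h2, h0, h', map_add, ← add_assoc, h3, zero_add, map_smul]
  -- This is `x ↦ ½(σ'σ⁻¹)(2x)`: the linear part is kept and the translation `2w'δ` is halved.
  obtain ⟨τ, hτ⟩ := exists_affine_of_mem (w' δ) (weylGroup_mem_corootLattice hw' δ hδmem) hw
  have hτσ : τ.1 ((1 / 2 : ℝ) • σ.1 (twoRho b)) = (1 / 2 : ℝ) • σ'.1 (twoRho b) := by
    have h1 : (σ' * σ⁻¹).1 (σ.1 (twoRho b)) = σ'.1 (twoRho b) := by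
      change σ'.1 ((σ⁻¹).1 _) = _
      rw [inv_apply_apply]
    rw [hτ, ← h1, h, hγδ, map_smul]
    module
  rw [mem_truncatedElements_iff_half] at hσ hσ'
  have h1 := affineWeyl_eq_one τ.2 hσ (by rw [hτσ]; exact hσ')
  rw [h1] at hτσ
  refine alcoveWeight_injective (b := b) ?_
  rw [alcoveWeight, alcoveWeight]
  exact congrArg (· - rho b) hτσ

/-- Lift the parity to `γ`, and bring `½(2ρ - γ)` into the open alcove by some `τ`. Doubling back
gives `σ(x) = 2τ(½(x - γ))`, for which `σ⁻¹(0) = γ - 2w⁻¹δ` has the parity of `γ`. -/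
theorem parity_surjOn : Set.SurjOn (parity b) (truncatedElements b 2) Set.univ := by
  intro c _
  have hlift : ∀ i, ∃ n : ℤ, (n : ZMod 2) = c i := fun i ↦ ZMod.intCast_surjective (c i)
  choose n hn using hlift
  set γ := ∑ i, (n i : ℝ) • corootElt H i.1 with hγ
  have hγmem : γ ∈ corootLattice H := sum_coord_mem b n
  obtain ⟨t, ht⟩ := exists_affine_of_mem (-γ) (neg_mem hγmem) (one_mem (weylGroup H))
  obtain ⟨τ, hτmem, hτ⟩ := exists_affine_mem_openAlcove b
    (x := (1 / 2 : ℝ) • t.1 (twoRho b)) fun φ k hk ↦ by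
      -- The halved point is off the walls: the value `k` there would mean the value `2k` at a point
      -- of an open alcove.
      refine rootForm_affine_ne_int t.2 (twoRho_mem_openAlcove (b := b)) φ (2 * k) ?_
      rw [map_smul, smul_eq_mul] at hk
      push_cast
      linarith
  obtain ⟨δ, hδ, w, hw, h⟩ := hτmem
  obtain ⟨σ, hσ⟩ := exists_affine_of_mem ((2 : ℝ) • δ - w γ)
    (sub_mem (by
      rw [two_smul]
      exact add_mem hδ hδ) (weylGroup_mem_corootLattice hw γ hγmem)) hw
  have hσz : (1 / 2 : ℝ) • σ.1 (twoRho b) = τ ((1 / 2 : ℝ) • t.1 (twoRho b)) := by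
    rw [hσ, h, ht, map_smul, map_add, map_neg]
    change _ = δ + (1 / 2 : ℝ) • (-w γ + w (twoRho b))
    module
  refine ⟨σ, ?_, ?_⟩
  · rw [mem_truncatedElements_iff_half, hσz]
    exact hτ
  · obtain ⟨m, hm⟩ := exists_coord b
      (weylGroup_mem_corootLattice (inv_mem hw) δ hδ)
    have hww : ∀ y, w (w⁻¹ y) = y := fun y ↦ w.apply_symm_apply y
    have h1 : (σ⁻¹).1 0 = ∑ i, ((n i - 2 * m i : ℤ) : ℝ) • corootElt H i.1 := by
      have h2 : ∑ i, ((n i - 2 * m i : ℤ) : ℝ) • corootElt H i.1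
          = γ - (2 : ℝ) • w⁻¹ δ := by
        rw [hm, hγ, Finset.smul_sum, ← Finset.sum_sub_distrib]
        refine Finset.sum_congr rfl fun i _ ↦ ?_
        push_cast
        module
      rw [h2]
      apply σ.1.injective
      rw [apply_inv_apply, hσ, map_sub, map_smul, hww]
      abel
    funext i
    rw [parity_eq h1, ← hn i]
    push_cast
    have : (2 : ZMod 2) = 0 := rfl
    rw [this, zero_mul, sub_zero]

theorem card_truncatedElements :
    Nat.card (truncatedElements b 2) = 2 ^ Module.finrank ℂ H := by
  have hbij : Set.BijOn (parity b) (truncatedElements b 2) Set.univ :=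
    ⟨fun _ _ ↦ Set.mem_univ _, parity_injOn, parity_surjOn⟩
  rw [Nat.card_congr hbij.equiv, Nat.card_congr (Equiv.Set.univ _), Nat.card_fun,
    Module.finrank_eq_card_basis b.toCoweightBasis]
  simp

end

end LieAlcove

end

theorem theorem4p4 {𝔤 : Type*} [LieRing 𝔤] [LieAlgebra ℂ 𝔤] [FiniteDimensional ℂ 𝔤]
    [LieAlgebra.IsSimple ℂ 𝔤] (H : LieSubalgebra ℂ 𝔤) [H.IsCartanSubalgebra]
    (b : (LieAlgebra.IsKilling.rootSystem H).Base) :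
    (∀ ξ : LieAlcove.AbelianIdeal b, ∃! σ : LieAlcove.affineWeylGroup H,
      σ ∈ LieAlcove.dominantElements b ∧
        LieAlcove.idealWeight b ξ = LieAlcove.alcoveWeight b σ) ∧
    (∃ s : LieAlcove.AbelianIdeal b → LieAlcove.affineWeylGroup H,
      (∀ ξ, s ξ ∈ LieAlcove.dominantElements b ∧
        LieAlcove.idealWeight b ξ = LieAlcove.alcoveWeight b (s ξ)) ∧
      (∀ ξ, s ξ ∈ LieAlcove.truncatedElements b 2) ∧
      Set.BijOn s Set.univ (LieAlcove.truncatedElements b 2)) ∧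
    Set.range (LieAlcove.idealWeight b) ⊆ LieAlcove.alcoveWeights b ∧
    Nat.card (LieAlcove.AbelianIdeal b) = 2 ^ Module.finrank ℂ H := by
  have hs : ∀ ξ : LieAlcove.AbelianIdeal b,
      LieAlcove.idealElement b ξ ∈ LieAlcove.dominantElements b ∧
        LieAlcove.idealWeight b ξ = LieAlcove.alcoveWeight b (LieAlcove.idealElement b ξ) :=
    fun ξ ↦ ⟨(LieAlcove.idealElement_mem ξ).1, LieAlcove.idealWeight_eq ξ⟩
  refine ⟨fun ξ ↦ ⟨LieAlcove.idealElement b ξ, hs ξ, ?_⟩,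
    ⟨LieAlcove.idealElement b, hs, LieAlcove.idealElement_mem, LieAlcove.bijOn_idealElement⟩,
    ?_, ?_⟩
  · rintro σ ⟨-, hσ⟩
    exact LieAlcove.alcoveWeight_injective (b := b) (hσ.symm.trans (hs ξ).2)
  · rintro _ ⟨ξ, rfl⟩
    exact ⟨LieAlcove.idealElement b ξ, (hs ξ).1, (hs ξ).2.symm⟩
  · rw [← LieAlcove.card_truncatedElements (b := b),
      ← Nat.card_congr LieAlcove.bijOn_idealElement.equiv, Nat.card_congr (Equiv.Set.univ _)]
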